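/- Let $\mathbb F_q$ be a finite field and $k=\mathbb F_q(T)$ the rational function field over $\mathbb F_q$. Let $L/k$ be an abelian extension, finite or infinite (that is, a Galois extension with commutative Galois group). For a prime divisor $\mathfrak P$ of $L$ (a valuation ring of $L$ different from $L$ and containing $\mathbb F_q$) lying over the prime divisor $\mathfrak p$ of $k$, with value groups $\Gamma_{\mathfrak p}\subseteq\Gamma_{\mathfrak P}$, let $e(\mathfrak P|\mathfrak p)=[\Gamma_{\mathfrak P}:\Gamma_{\mathfrak p}]$ be the ramification index. Call $\mathfrak p$ ramified in $L$ if $e(\mathfrak P|\mathfrak p)\neq 1$ for some $\mathfrak P$ over $\mathfrak p$, and call $L/k$ tamely ramified if for every prime divisor $\mathfrak P$ of $L$ the characteristic of $\mathbb F_q$ divides the order of no element of $\Gamma_{\mathfrak P}/\Gamma_{\mathfrak p}$ (for finite $L/k$: does not divide $e(\mathfrak P|\mathfrak p)$). The degree of $\mathfrak p$ is the degree of its residue field over $\mathbb F_q$. Suppose that $L/k$ is tamely ramified and that there is a prime divisor $\mathfrak p_0$ of $k$ of degree $1$ such that no prime divisor of $k$ other than $\mathfrak p_0$ is ramified in $L$.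 Then $L/k$ is a constant extension, that is, $L=kE$ for some field $E\subseteq L$ that contains $\mathbb F_q$ and is algebraic over $\mathbb F_q$. -/

import Mathlib

/-- A prime divisor of a field `K` over a field of constants `F`: a valuation ring of `K`,
different from `K`, that contains `F`. -/
structure PrimeDivisor (F K : Type*) [Field F] [Field K] [Algebra F K] where
  /-- the valuation ring of the prime divisor -/
  ring : ValuationSubring K
  ne_top : ring ≠ ⊤
  algebraMap_mem : ∀ c : F, algebraMap F K c ∈ ring

namespace PrimeDivisor

/-- The valuation ring of a prime divisor is an algebra over the constants. -/
noncomputable instance algebraRing {F K : Type*} [Field F] [Field K] [Algebra F K]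
    (P : PrimeDivisor F K) : Algebra F P.ring :=
  ((algebraMap F K).codRestrict P.ring.toSubring P.algebraMap_mem).toAlgebra

/-- The degree of a prime divisor: the degree of its residue field over the constants. -/
noncomputable def degree {F K : Type*} [Field F] [Field K] [Algebra F K]
    (P : PrimeDivisor F K) : ℕ :=
  Module.finrank F (IsLocalRing.ResidueField P.ring)

/-- `Q` lies over `P`: the valuation ring of `Q` intersects `K` in the valuation ring of `P`. -/
def LiesOver {F K L : Type*} [Field F] [Field K] [Algebra F K] [Field L] [Algebra F L]
    [Algebra K L] (Q : PrimeDivisor F L) (P : PrimeDivisor F K) : Prop :=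
  ∀ x : K, algebraMap K L x ∈ Q.ring ↔ x ∈ P.ring

/-- The subgroup `𝒪_Qˣ Kˣ` of `Lˣ`. Since the value group of `Q` is `Lˣ / 𝒪_Qˣ`, the quotient of
`Lˣ` by this subgroup is the value group of `Q` modulo the value group of the restriction
of `Q` to `K`. -/
noncomputable def unitsMulBase (K : Type*) {F L : Type*} [Field F] [Field K] [Field L] [Algebra F L]
    [Algebra K L] (Q : PrimeDivisor F L) : Subgroup Lˣ :=
  Q.ring.unitGroup ⊔ (Units.map (algebraMap K L : K →* L)).range

/-- The ramification index over `K` of a prime divisor `Q` of `L`: the index of the value group of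
the restriction of `Q` to `K` in the value group of `Q` (with value `0` if it is infinite). -/
noncomputable def ramificationIndex (K : Type*) {F L : Type*} [Field F] [Field K] [Field L]
    [Algebra F L] [Algebra K L] (Q : PrimeDivisor F L) : ℕ :=
  (Q.unitsMulBase K).index

/-- A prime divisor `P` of `K` is ramified in `L` if some prime divisor of `L` over `P` has
ramification index different from `1`. (In the intended use all residue fields are algebraic
over a finite field, so that residue extensions are always separable.) -/
def IsRamifiedIn {F K : Type*} [Field F] [Field K] [Algebra F K] (P : PrimeDivisor F K)
    (L : Type*) [Field L] [Algebra F L] [Algebra K L] : Prop :=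
  ∃ Q : PrimeDivisor F L, Q.LiesOver P ∧ Q.ramificationIndex K ≠ 1

/-- A prime divisor `Q` of an algebraic extension `L` of `K` is tamely ramified over `K` (possibly
unramified) if the residue characteristic divides the order of no element of the quotient of
the value groups. If the ramification index is finite, this says that the residue
characteristic does not divide it: see `isTameOver_iff`. -/
def IsTameOver (K : Type*) {F L : Type*} [Field F] [Field K] [Field L]
    [Algebra F L] [Algebra K L] (Q : PrimeDivisor F L) : Prop :=
  ∀ g : Lˣ ⧸ Q.unitsMulBase K, ¬ ringChar (IsLocalRing.ResidueField Q.ring) ∣ orderOf g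

theorem isTameOver_iff {F K L : Type*} [Field F] [Field K] [Field L]
    [Algebra F L] [Algebra K L] (Q : PrimeDivisor F L) (h : Q.ramificationIndex K ≠ 0) :
    Q.IsTameOver K ↔
      ¬ ringChar (IsLocalRing.ResidueField Q.ring) ∣ Q.ramificationIndex K := by
  have hcard : Nat.card (Lˣ ⧸ Q.unitsMulBase K) = Q.ramificationIndex K := rfl
  have : Finite (Lˣ ⧸ Q.unitsMulBase K) := Nat.finite_of_card_ne_zero (hcard ▸ h)
  constructor
  · intro ht hd
    rcases CharP.char_is_prime_or_zero (IsLocalRing.ResidueField Q.ring)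
      (ringChar (IsLocalRing.ResidueField Q.ring)) with hp | h0
    · have : Fact (ringChar (IsLocalRing.ResidueField Q.ring)).Prime := ⟨hp⟩
      obtain ⟨g, hg⟩ := exists_prime_orderOf_dvd_card' _ (hcard ▸ hd)
      exact ht g (hg ▸ dvd_rfl)
    · rw [h0, zero_dvd_iff] at hd
      exact h hd
  · intro hn g hg
    exact hn (hcard ▸ hg.trans (orderOf_dvd_natCard g))

end PrimeDivisor

/-- The extension `L / K` is tamely ramified, with constants `F`: every prime divisor of `L` is
tamely ramified over `K`. -/
def IsTamelyRamifiedExtension (F K L : Type*) [Field F] [Field K] [Field L]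
    [Algebra F L] [Algebra K L] : Prop :=
  ∀ Q : PrimeDivisor F L, Q.IsTameOver K

/-- `L / K` is a constant extension: `L = K E` for some extension `E` of the field of constants `F`,
contained in `L` and algebraic over `F`. -/
def IsConstantExtension (F K L : Type*) [Field F] [Field K] [Field L]
    [Algebra F L] [Algebra K L] : Prop :=
  ∃ E : IntermediateField F L, Algebra.IsAlgebraic F E ∧
    IntermediateField.adjoin K (E : Set L) = ⊤

/-! Let `C` be the algebraic closure of `F` in `L` and `M = C(t)`. If `M ≠ L`, commutativity of the
Galois group gives `N` between `M` and `L` with `N / M` of prime degree `l`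
(`exists_intermediateField_finrank_prime`); both possibilities for `l` are refuted.

If `l` is the characteristic `p`, then `N` contains an Artin-Schreier element `y` outside `M`, with
`y ^ p - y` in `C(t)`. A pole of order prime to `p` would give `y` a value of order `p` modulo the
values of `k`, against tameness. A pole of order divisible by `p` can be lowered by changing `y`
modulo `C(t)`, because residue fields are perfect. So `y` may be taken with `y ^ p - y` constant;
then `y` is algebraic over `F` and lies in `M` (`false_of_finrank_eq_char`).

If `l` is not the characteristic, pass to an algebraic closure `Ω` of `L`, with constants `C'`
algebraically closed. The Lagrange resolvents of an element of `N` have their `l`-th powers in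
`C'(t)`. Away from `p₀` nothing ramifies, so these powers have zeros and poles of order divisible by
`l`. As `p₀` has degree one, just one place of `C'(t)` lies above it, and there the order is
divisible by `l` too, since the orders sum to zero. So the resolvents lie in `C'(t)`, and `N` in
`C'(t) ∩ L = C(t) = M` (`false_of_finrank_ne_char`). -/

open Polynomial IntermediateField

/-! ### Valuations of polynomials in a transcendental element -/

section Places

variable {F E Λ : Type*} [Field F] [Field E] [Field Λ] [Algebra F E] [Algebra E Λ]

theorem ValuationSubring.aeval_mem (V : ValuationSubring Λ) (hE : ∀ c : E, algebraMap E Λ c ∈ V)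
    {t : Λ} (ht : t ∈ V) (q : E[X]) : aeval t q ∈ V := by
  rw [aeval_eq_sum_range]
  refine sum_mem fun i _ => ?_
  rw [Algebra.smul_def]
  exact V.mul_mem _ _ (hE _) (pow_mem ht _)

theorem ValuationSubring.valuation_aeval_eq_one_of_isCoprime (V : ValuationSubring Λ)
    (hE : ∀ c : E, algebraMap E Λ c ∈ V) {t : Λ} (ht : t ∈ V) {π q : E[X]}
    (hπ : V.valuation (aeval t π) < 1) (h : IsCoprime π q) : V.valuation (aeval t q) = 1 := by
  obtain ⟨a, b, hab⟩ := h
  have hq := (V.valuation_le_one_iff _).2 (V.aeval_mem hE ht q)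
  refine le_antisymm hq (le_of_not_gt fun hlt => ?_)
  have h1 : aeval t a * aeval t π + aeval t b * aeval t q = 1 := by
    rw [← map_mul, ← map_mul, ← map_add, hab, map_one]
  have ha := (V.valuation_le_one_iff _).2 (V.aeval_mem hE ht a)
  have hb := (V.valuation_le_one_iff _).2 (V.aeval_mem hE ht b)
  have := V.valuation.map_add_lt (g := 1)
    (x := aeval t a * aeval t π) (y := aeval t b * aeval t q)
    (by rw [map_mul]; exact mul_lt_one_of_nonneg_of_lt_one_right ha zero_le hπ)
    (by rw [map_mul]; exact mul_lt_one_of_nonneg_of_lt_one_right hb zero_le hlt)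
  rw [h1, map_one] at this
  exact lt_irrefl _ this

/-- A nonconstant polynomial in a transcendental element is a nonunit of some valuation ring
that contains the constants. -/
theorem exists_valuationSubring_valuation_aeval_lt_one {t : Λ} (ht : Transcendental E t) {π : E[X]}
    (hπ : ¬ IsUnit π) :
    ∃ V : ValuationSubring Λ, (∀ c : E, algebraMap E Λ c ∈ V) ∧ t ∈ V ∧
      V.valuation (aeval t π) < 1 := by
  let A : Subring Λ := (Algebra.adjoin E {t}).toSubring
  have hA : ∀ q : E[X], aeval t q ∈ A := fun q => by
    change aeval t q ∈ Algebra.adjoin E {t}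
    exact aeval_mem_adjoin_singleton E t
  let x : A := ⟨aeval t π, hA π⟩
  have hI : Ideal.span {x} ≠ ⊤ := by
    rw [Ne, Ideal.span_singleton_eq_top]
    rintro hu
    obtain ⟨b, hb⟩ := hu.exists_right_inv
    have hb' : (b : Λ) ∈ Algebra.adjoin E {t} := b.2
    rw [Algebra.adjoin_singleton_eq_range_aeval] at hb'
    obtain ⟨g, hg⟩ := hb'
    have h1 : aeval t (π * g) = aeval t (1 : E[X]) := by
      rw [map_mul, map_one]
      have := congrArg (Subtype.val) hb
      simpa [x, ← hg] using this
    exact hπ (IsUnit.of_mul_eq_one _ (transcendental_iff_injective.1 ht h1))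
  -- A proper ideal of a subring of a field lies in the nonunits of some valuation ring containing
  -- the subring.
  obtain ⟨V, hAV, hV⟩ := Ideal.image_subset_nonunits_valuationSubring _ hI
  refine ⟨V, fun c => hAV ?_, hAV ?_, ?_⟩
  · simpa using hA (C c)
  · simpa using hA X
  · exact hV ⟨x, Ideal.mem_span_singleton_self x, rfl⟩

/-- Write `q(t) = t ^ n * q*(t⁻¹)` with `q*` the reversed polynomial: its constant term is the
leading coefficient of `q`, so it is prime to `X` and has value one at `t⁻¹`. -/
theorem ValuationSubring.valuation_aeval_of_one_lt (V : ValuationSubring Λ)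
    (hE : ∀ c : E, algebraMap E Λ c ∈ V) {t : Λ} (ht : 1 < V.valuation t) {q : E[X]} (hq : q ≠ 0) :
    V.valuation (aeval t q) = V.valuation t ^ q.natDegree := by
  have ht0 : t ≠ 0 := by
    rintro rfl
    simp at ht
  have hinv : V.valuation t⁻¹ < 1 := by
    rw [map_inv₀]
    exact inv_lt_one_of_one_lt₀ ht
  let : Invertible t := invertibleOfNonzero ht0
  have h := eval₂_reverse_mul_pow (algebraMap E Λ) t q
  rw [invOf_eq_inv] at h
  rw [aeval_def, ← h, map_mul, map_pow, ← aeval_def]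
  rw [V.valuation_aeval_eq_one_of_isCoprime hE (π := X), one_mul]
  · exact (V.valuation_le_one_iff _).1 hinv.le
  · simpa using hinv
  · rw [irreducible_X.coprime_iff_not_dvd, X_dvd_iff, coeff_zero_reverse]
    simpa using hq

theorem ValuationSubring.valuation_aeval_of_lt_one (V : ValuationSubring Λ)
    (hE : ∀ c : E, algebraMap E Λ c ∈ V) {t : Λ} (ht : t ∈ V) {π q : E[X]} (hπ : Irreducible π)
    (hV : V.valuation (aeval t π) < 1) (hq : ¬ π ∣ q) (n : ℕ) :
    V.valuation (aeval t (π ^ n * q)) = V.valuation (aeval t π) ^ n := by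
  rw [map_mul, map_mul, map_pow, map_pow, V.valuation_aeval_eq_one_of_isCoprime hE ht hV
    (hπ.coprime_iff_not_dvd.2 hq), mul_one]

/-- An irreducible polynomial over an algebraic extension of a perfect field divides exactly once
some polynomial over the base. -/
theorem Irreducible.exists_map_eq_mul [PerfectField F] [Algebra.IsAlgebraic F E] {π : E[X]}
    (hπ : Irreducible π) :
    ∃ (p : F[X]) (g : E[X]), p ≠ 0 ∧ p.map (algebraMap F E) = π * g ∧ IsCoprime π g := by
  have : Fact (Irreducible π) := ⟨hπ⟩
  let α := AdjoinRoot.root π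
  have hαE : IsAlgebraic E α := ⟨π, hπ.ne_zero, by simp [α, aeval_def, AdjoinRoot.algebraMap_eq]⟩
  have hα : IsAlgebraic F α := hαE.restrictScalars F
  have hirr := minpoly.irreducible hα.isIntegral
  have hdvd : π ∣ (minpoly F α).map (algebraMap F E) := by
    rw [← AdjoinRoot.mk_eq_zero, ← AdjoinRoot.aeval_eq, aeval_map_algebraMap]
    exact minpoly.aeval F α
  obtain ⟨g, hg⟩ := hdvd
  refine ⟨minpoly F α, g, hirr.ne_zero, hg, ?_⟩
  rw [hπ.coprime_iff_not_dvd]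
  rintro ⟨g', rfl⟩
  -- Perfectness of `F` makes the minimal polynomial of a root of `π` separable, so `π` cannot
  -- divide it twice.
  have hsq : Squarefree ((minpoly F α).map (algebraMap F E)) :=
    ((PerfectField.separable_of_irreducible hirr).map).squarefree
  exact hπ.not_isUnit (hsq π ⟨g', by rw [hg, mul_assoc]⟩)

theorem Subgroup.mem_of_pow_mem_of_coprime {G : Type*} [Group G] (H : Subgroup G) {g : G} {m n : ℕ}
    (hm : g ^ m ∈ H) (hn : g ^ n ∈ H) (h : m.Coprime n) : g ∈ H := by
  have h1 : g = (g ^ m) ^ m.gcdA n * (g ^ n) ^ m.gcdB n := by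
    rw [← zpow_natCast, ← zpow_natCast, ← zpow_mul, ← zpow_mul, ← zpow_add, ← Nat.gcd_eq_gcd_ab,
      h.gcd_eq_one]
    simp
  rw [h1]
  exact mul_mem (zpow_mem hm _) (zpow_mem hn _)

end Places

/-! ### Values taken on the base field -/

section BaseValued

variable (k : Type*) {Λ : Type*} [Field k] [Field Λ] [Algebra k Λ]

/-- The elements of `Λˣ` whose value is the value of an element of `k`. -/
noncomputable def ValuationSubring.baseValued (V : ValuationSubring Λ) : Subgroup Λˣ :=
  V.unitGroup ⊔ (Units.map (algebraMap k Λ : k →* Λ)).range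

variable {k}

theorem ValuationSubring.mem_baseValued_iff {V : ValuationSubring Λ} {g : Λˣ} :
    g ∈ V.baseValued k ↔ ∃ b : k, V.valuation g = V.valuation (algebraMap k Λ b) := by
  rw [baseValued, Subgroup.mem_sup]
  constructor
  · rintro ⟨u, hu, _, ⟨b, rfl⟩, rfl⟩
    refine ⟨b, ?_⟩
    rw [V.mem_unitGroup_iff] at hu
    simp [hu]
  · rintro ⟨b, hb⟩
    have hb0 : b ≠ 0 := by
      rintro rfl
      simp at hb
    refine ⟨g * (Units.map (algebraMap k Λ : k →* Λ) (Units.mk0 b hb0))⁻¹, ?_, _,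
      ⟨Units.mk0 b hb0, rfl⟩, by simp⟩
    rw [V.mem_unitGroup_iff]
    simp [hb, hb0]

/-- `s` has the value of an element of `k`, and its value generates the values of `k`. -/
structure ValuationSubring.IsBaseUniformizer (k : Type*) {Λ : Type*} [Field k] [Field Λ]
    [Algebra k Λ] (V : ValuationSubring Λ) (s : Λ) : Prop where
  ne_zero : s ≠ 0
  lt_one : V.valuation s < 1
  exists_base : ∃ b : k, V.valuation s = V.valuation (algebraMap k Λ b)
  eq_zpow : ∀ b : k, b ≠ 0 → ∃ n : ℤ, V.valuation (algebraMap k Λ b) = V.valuation s ^ n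

namespace ValuationSubring.IsBaseUniformizer

variable {V : ValuationSubring Λ} {s : Λ}

theorem zpow_inj (h : V.IsBaseUniformizer k s) {m n : ℤ}
    (hmn : V.valuation s ^ m = V.valuation s ^ n) : m = n :=
  zpow_right_injective₀ ((Valuation.pos_iff _).2 h.ne_zero) h.lt_one.ne hmn

theorem mem_baseValued_of_eq_zpow (h : V.IsBaseUniformizer k s) {z : Λˣ} {m : ℤ}
    (hz : V.valuation z = V.valuation s ^ m) : z ∈ V.baseValued k := by
  obtain ⟨b, hb⟩ := h.exists_base
  exact mem_baseValued_iff.2 ⟨b ^ m, by rw [map_zpow₀, map_zpow₀, ← hb, hz]⟩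

theorem dvd_of_pow_eq (h : V.IsBaseUniformizer k s) {z : Λˣ} {l : ℕ} {m : ℤ}
    (hz : z ∈ V.baseValued k) (hm : V.valuation (z : Λ) ^ l = V.valuation s ^ m) :
    (l : ℤ) ∣ m := by
  obtain ⟨b, hb⟩ := mem_baseValued_iff.1 hz
  have hb0 : b ≠ 0 := by
    rintro rfl
    simp at hb
  obtain ⟨n, hn⟩ := h.eq_zpow b hb0
  refine ⟨n, ?_⟩
  apply h.zpow_inj
  rw [← hm, hb, hn, mul_comm, zpow_mul, zpow_natCast]

end ValuationSubring.IsBaseUniformizer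

end BaseValued

/-! ### Places over the rational function field and their uniformizers -/

section RatFuncPlaces

variable {F E Λ : Type*} [Field F] [Field E] [Field Λ] [Algebra F E] [Algebra E Λ] [Algebra F Λ]
  [IsScalarTower F E Λ] [Algebra (RatFunc F) Λ] [IsScalarTower F (RatFunc F) Λ]

theorem RatFunc.algebraMap_algebraMap_eq_aeval (p : F[X]) :
    algebraMap (RatFunc F) Λ (algebraMap F[X] (RatFunc F) p) =
      aeval (algebraMap (RatFunc F) Λ RatFunc.X) p := by
  rw [aeval_algebraMap_apply]
  congr 1
  rw [← RatFunc.algebraMap_X, aeval_algebraMap_apply, aeval_X_left_apply]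

variable (F Λ) in
theorem RatFunc.transcendental_algebraMap_X :
    Transcendental F (algebraMap (RatFunc F) Λ RatFunc.X) := by
  rw [transcendental_iff]
  intro p hp
  rw [← RatFunc.algebraMap_algebraMap_eq_aeval] at hp
  simpa using hp

variable (F E Λ) in
theorem RatFunc.transcendental_algebraMap_X_of_isAlgebraic [Algebra.IsAlgebraic F E] :
    Transcendental E (algebraMap (RatFunc F) Λ RatFunc.X) := by
  intro h
  exact RatFunc.transcendental_algebraMap_X F Λ (h.restrictScalars F)

theorem RatFunc.exists_algebraMap_eq_div (b : RatFunc F) (hb : b ≠ 0) :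
    ∃ p q : F[X], p ≠ 0 ∧ q ≠ 0 ∧ algebraMap (RatFunc F) Λ b =
      aeval (algebraMap (RatFunc F) Λ RatFunc.X) p /
        aeval (algebraMap (RatFunc F) Λ RatFunc.X) q := by
  refine ⟨b.num, b.denom, RatFunc.num_ne_zero hb, b.denom_ne_zero, ?_⟩
  rw [← RatFunc.algebraMap_algebraMap_eq_aeval, ← RatFunc.algebraMap_algebraMap_eq_aeval,
    ← map_div₀, RatFunc.num_div_denom]

/-- Constant extensions are unramified: `π` divides some polynomial over `F` exactly once, so the
value of `π(t)` already occurs on `F(t)`. -/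
theorem ValuationSubring.isBaseUniformizer_aeval [PerfectField F] [Algebra.IsAlgebraic F E]
    (V : ValuationSubring Λ) (hE : ∀ c : E, algebraMap E Λ c ∈ V)
    (ht : algebraMap (RatFunc F) Λ RatFunc.X ∈ V) {π : E[X]} (hπ : Irreducible π)
    (hV : V.valuation (aeval (algebraMap (RatFunc F) Λ RatFunc.X) π) < 1) :
    V.IsBaseUniformizer (RatFunc F) (aeval (algebraMap (RatFunc F) Λ RatFunc.X) π) := by
  have key : ∀ p : F[X], p ≠ 0 → ∃ n : ℕ, V.valuation
      (aeval (algebraMap (RatFunc F) Λ RatFunc.X) p) =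
      V.valuation (aeval (algebraMap (RatFunc F) Λ RatFunc.X) π) ^ n := by
    intro p hp
    have hp' : p.map (algebraMap F E) ≠ 0 :=
      (Polynomial.map_ne_zero_iff (algebraMap F E).injective).2 hp
    obtain ⟨q, hpq, hq⟩ :=
      (FiniteMultiplicity.of_not_isUnit hπ.not_isUnit hp').exists_eq_pow_mul_and_not_dvd
    refine ⟨multiplicity π (p.map (algebraMap F E)), ?_⟩
    rw [← V.valuation_aeval_of_lt_one hE ht hπ hV hq, ← hpq, aeval_map_algebraMap]
  refine ⟨?_, hV, ?_, ?_⟩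
  · intro h0
    exact hπ.ne_zero (transcendental_iff.1
      (RatFunc.transcendental_algebraMap_X_of_isAlgebraic F E Λ) _ h0)
  · obtain ⟨p, g, hp, hpg, hc⟩ := hπ.exists_map_eq_mul (F := F)
    refine ⟨algebraMap F[X] (RatFunc F) p, ?_⟩
    rw [RatFunc.algebraMap_algebraMap_eq_aeval, ← aeval_map_algebraMap E _ p, hpg, map_mul, map_mul,
      V.valuation_aeval_eq_one_of_isCoprime hE ht hV hc, mul_one]
  · intro b hb
    obtain ⟨p, q, hp, hq, hpq⟩ := RatFunc.exists_algebraMap_eq_div (Λ := Λ) b hb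
    obtain ⟨m, hm⟩ := key p hp
    obtain ⟨n, hn⟩ := key q hq
    refine ⟨m - n, ?_⟩
    rw [hpq, map_div₀, hm, hn, zpow_sub₀, zpow_natCast, zpow_natCast]
    intro h0
    rw [Valuation.zero_iff] at h0
    exact hπ.ne_zero (transcendental_iff.1
      (RatFunc.transcendental_algebraMap_X_of_isAlgebraic F E Λ) _ h0)

theorem ValuationSubring.isBaseUniformizer_inv_X
    (V : ValuationSubring Λ) (hF : ∀ c : F, algebraMap F Λ c ∈ V)
    (ht : 1 < V.valuation (algebraMap (RatFunc F) Λ RatFunc.X)) :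
    V.IsBaseUniformizer (RatFunc F) (algebraMap (RatFunc F) Λ RatFunc.X)⁻¹ := by
  have h0 : algebraMap (RatFunc F) Λ RatFunc.X ≠ 0 := by simpa using RatFunc.X_ne_zero
  refine ⟨inv_ne_zero h0, ?_, ⟨RatFunc.X⁻¹, by rw [map_inv₀ (algebraMap (RatFunc F) Λ)]⟩, ?_⟩
  · rw [map_inv₀]
    exact inv_lt_one_of_one_lt₀ ht
  · intro b hb
    obtain ⟨p, q, hp, hq, hpq⟩ := RatFunc.exists_algebraMap_eq_div (Λ := Λ) b hb
    refine ⟨q.natDegree - p.natDegree, ?_⟩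
    rw [hpq, map_div₀, V.valuation_aeval_of_one_lt hF ht hp, V.valuation_aeval_of_one_lt hF ht hq,
      map_inv₀, inv_zpow', neg_sub, zpow_sub₀ (by simpa using RatFunc.X_ne_zero), zpow_natCast,
      zpow_natCast]

end RatFuncPlaces

theorem ValuationSubring.ne_top_of_valuation_lt_one {Λ : Type*} [Field Λ] {V : ValuationSubring Λ}
    {x : Λ} (hx : x ≠ 0) (h : V.valuation x < 1) : V ≠ ⊤ := by
  intro hV
  have h1 : x⁻¹ ∈ V := hV ▸ ValuationSubring.mem_top _
  rw [← V.valuation_le_one_iff, map_inv₀] at h1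
  exact absurd h1 (not_le_of_gt ((one_lt_inv₀ ((Valuation.pos_iff _).2 hx)).2 h))

theorem ValuationSubring.exists_one_lt_valuation {E Λ : Type*} [Field E] [Field Λ] [Algebra E Λ]
    {t : Λ} (ht : Transcendental E t) :
    ∃ V : ValuationSubring Λ, (∀ c : E, algebraMap E Λ c ∈ V) ∧ 1 < V.valuation t := by
  have ht' : Transcendental E t⁻¹ := fun h => ht (by simpa using h.inv)
  obtain ⟨V, hE, -, hV⟩ := exists_valuationSubring_valuation_aeval_lt_one ht'
    (irreducible_X (R := E)).not_isUnit
  refine ⟨V, hE, ?_⟩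
  rw [aeval_X, map_inv₀] at hV
  refine (inv_lt_one₀ ((Valuation.pos_iff _).2 ?_)).1 hV
  rintro rfl
  exact ht isAlgebraic_zero

/-- At a pole, `y ^ p` dominates `y`, so the value of `y ^ p` is `s ^ (-m)`. Tameness, in the form
`H`, then makes the value of `y` itself an integral power of that of `s`. -/
theorem ValuationSubring.IsBaseUniformizer.dvd_of_artinSchreier {k Λ : Type*} [Field k] [Field Λ]
    [Algebra k Λ] {V : ValuationSubring Λ} {s : Λ} (hs : V.IsBaseUniformizer k s) {p : ℕ}
    (hp : 1 < p) (H : ∀ z : Λˣ, z ^ p ∈ V.baseValued k → z ∈ V.baseValued k) {y : Λ} {m : ℕ}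
    (hm : 0 < m) (hy : V.valuation (y ^ p - y) = V.valuation s ^ (-m : ℤ)) : p ∣ m := by
  have h1 : 1 < V.valuation (y ^ p - y) := by
    rw [hy, zpow_neg, zpow_natCast]
    exact (one_lt_inv₀ (pow_pos ((Valuation.pos_iff _).2 hs.ne_zero) _)).2
      (pow_lt_one₀ zero_le hs.lt_one hm.ne')
  have h2 : 1 < V.valuation y := by
    by_contra! h
    have hyV := (V.valuation_le_one_iff _).1 h
    exact not_le_of_gt h1 ((V.valuation_le_one_iff _).2 (sub_mem (pow_mem hyV p) hyV))
  have h3 : V.valuation (y ^ p - y) = V.valuation y ^ p := by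
    rw [Valuation.map_sub_eq_of_lt_left, map_pow]
    rw [map_pow]
    exact lt_self_pow₀ h2 hp
  have hy0 : y ≠ 0 := by
    rintro rfl
    simp at h2
  have hz : V.valuation (Units.mk0 y hy0 : Λ) ^ p = V.valuation s ^ (-m : ℤ) := by
    rw [Units.val_mk0, ← h3, hy]
  have h4 := hs.dvd_of_pow_eq (H (Units.mk0 y hy0)
    (hs.mem_baseValued_of_eq_zpow (m := -m) (by rw [Units.val_pow_eq_pow_val, map_pow, hz]))) hz
  rwa [dvd_neg, Int.natCast_dvd_natCast] at h4

/-- The residue field `E[X]/(π)` is finite over a perfect field, hence perfect, so `P / Q` has a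
`p`-th root in it. -/
theorem Irreducible.exists_dvd_sub_pow_mul {E : Type*} [Field E] [PerfectField E] {p : ℕ}
    [Fact p.Prime] [CharP E p] {π : E[X]} (hπ : Irreducible π) (P : E[X]) {Q : E[X]}
    (hQ : ¬ π ∣ Q) : ∃ w : E[X], π ∣ P - w ^ p * Q := by
  have : Fact (Irreducible π) := ⟨hπ⟩
  have : CharP (AdjoinRoot π) p := charP_of_injective_algebraMap
    (algebraMap E (AdjoinRoot π)).injective p
  have : FiniteDimensional E (AdjoinRoot π) := (AdjoinRoot.powerBasis hπ.ne_zero).finite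
  have : PerfectField (AdjoinRoot π) := Algebra.IsAlgebraic.perfectField E
  have : ExpChar (AdjoinRoot π) p := .prime Fact.out
  have hQ0 : AdjoinRoot.mk π Q ≠ 0 := by rwa [Ne, AdjoinRoot.mk_eq_zero]
  obtain ⟨u, hu⟩ := surjective_frobenius (AdjoinRoot π) p
    (AdjoinRoot.mk π P / AdjoinRoot.mk π Q)
  obtain ⟨w, rfl⟩ := AdjoinRoot.mk_surjective u
  refine ⟨w, ?_⟩
  rw [← AdjoinRoot.mk_eq_zero, map_sub, map_mul, map_pow, ← frobenius_def, hu,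
    div_mul_cancel₀ _ hQ0, sub_self]

/-! ### Reduction of Artin-Schreier equations to constant right-hand sides -/

section ArtinSchreier

variable {F E Λ : Type*} [Field F] [Field E] [Field Λ] [Algebra F E] [Algebra E Λ] [Algebra F Λ]
  [IsScalarTower F E Λ] [Algebra (RatFunc F) Λ] [IsScalarTower F (RatFunc F) Λ]

variable (F E Λ) in
theorem RatFunc.aeval_algebraMap_X_ne_zero [Algebra.IsAlgebraic F E] {q : E[X]} (hq : q ≠ 0) :
    aeval (algebraMap (RatFunc F) Λ RatFunc.X) q ≠ 0 := fun h =>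
  hq (transcendental_iff.1 (RatFunc.transcendental_algebraMap_X_of_isAlgebraic F E Λ) _ h)

theorem IntermediateField.aeval_mem_adjoin_simple {t : Λ} (q : E[X]) : aeval t q ∈ E⟮t⟯ :=
  (mem_adjoin_simple_iff E _).2 ⟨q, 1, by simp⟩

variable [PerfectField F] [Algebra.IsAlgebraic F E] {p : ℕ} [Fact p.Prime] [CharP E p]
  (H : ∀ V : ValuationSubring Λ, V ≠ ⊤ → (∀ c : F, algebraMap F Λ c ∈ V) →
    ∀ z : Λˣ, z ^ p ∈ V.baseValued (RatFunc F) → z ∈ V.baseValued (RatFunc F))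
include H

/-- The finite poles of the right-hand side of a tame Artin-Schreier equation can be removed. -/
theorem exists_sub_artinSchreier_eq_aeval (n : ℕ) : ∀ (y : Λ) (P Q : E[X]), Q ≠ 0 →
    Q.natDegree = n → aeval (algebraMap (RatFunc F) Λ RatFunc.X) Q * (y ^ p - y) =
      aeval (algebraMap (RatFunc F) Λ RatFunc.X) P →
    ∃ h ∈ E⟮algebraMap (RatFunc F) Λ RatFunc.X⟯, ∃ P' : E[X],
      (y - h) ^ p - (y - h) = aeval (algebraMap (RatFunc F) Λ RatFunc.X) P' := by
  set t := algebraMap (RatFunc F) Λ RatFunc.X with ht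
  have hpp : p.Prime := Fact.out
  have : CharP Λ p := charP_of_injective_algebraMap (algebraMap E Λ).injective p
  have : PerfectField E := Algebra.IsAlgebraic.perfectField F
  have hne : ∀ {q : E[X]}, q ≠ 0 → aeval t q ≠ 0 :=
    fun h => RatFunc.aeval_algebraMap_X_ne_zero F E Λ h
  induction n using Nat.strong_induction_on with
  | _ n ih =>
    intro y P Q hQ hn hyP
    by_cases hu : IsUnit Q
    · obtain ⟨c, hc, rfl⟩ := Polynomial.isUnit_iff.1 hu
      refine ⟨0, zero_mem _, C c⁻¹ * P, ?_⟩
      rw [map_mul, ← hyP, sub_zero, ← mul_assoc, ← map_mul, ← C_mul,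
        inv_mul_cancel₀ hc.ne_zero]
      simp
    obtain ⟨π, hπ, hπQ⟩ := WfDvdMonoid.exists_irreducible_factor hu hQ
    obtain ⟨m, Q₁, hQ₁, rfl⟩ : ∃ m Q₁, ¬ π ∣ Q₁ ∧ Q = π ^ m * Q₁ :=
      let ⟨c, h1, h2⟩ :=
        (FiniteMultiplicity.of_not_isUnit hπ.not_isUnit hQ).exists_eq_pow_mul_and_not_dvd
      ⟨_, c, h2, h1⟩
    obtain ⟨m, rfl⟩ : ∃ m', m = m' + 1 := by
      refine Nat.exists_eq_succ_of_ne_zero ?_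
      rintro rfl
      exact hQ₁ (by simpa using hπQ)
    have hQ' : π ^ m * Q₁ ≠ 0 := mul_ne_zero (pow_ne_zero _ hπ.ne_zero) fun h => hQ₁ (by simp [h])
    have hdeg : (π ^ m * Q₁).natDegree < n := by
      rw [← hn, pow_succ', mul_assoc, natDegree_mul hπ.ne_zero hQ']
      have := hπ.natDegree_pos
      omega
    by_cases hπP : π ∣ P
    · obtain ⟨P, rfl⟩ := hπP
      refine ih _ hdeg y P _ hQ' rfl ?_
      refine mul_left_cancel₀ (hne hπ.ne_zero) ?_
      rw [← map_mul, ← hyP, ← mul_assoc, ← map_mul, pow_succ', mul_assoc]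
    have hpm : p ∣ m + 1 := by
      obtain ⟨V, hE, htV, hV⟩ := exists_valuationSubring_valuation_aeval_lt_one
        (RatFunc.transcendental_algebraMap_X_of_isAlgebraic F E Λ) hπ.not_isUnit
      refine (V.isBaseUniformizer_aeval hE htV hπ hV).dvd_of_artinSchreier hpp.one_lt
        (H V (V.ne_top_of_valuation_lt_one (hne hπ.ne_zero) hV) fun c => ?_) m.succ_pos (y := y) ?_
      · rw [IsScalarTower.algebraMap_apply F E Λ]
        exact hE _
      · have h1 := congrArg V.valuation hyP
        rw [map_mul, V.valuation_aeval_of_lt_one hE htV hπ hV hQ₁,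
          V.valuation_aeval_eq_one_of_isCoprime hE htV hV (hπ.coprime_iff_not_dvd.2 hπP)] at h1
        rw [zpow_neg, zpow_natCast]
        exact eq_inv_of_mul_eq_one_right h1
    obtain ⟨r, hr⟩ := hpm
    obtain ⟨w, hw⟩ := hπ.exists_dvd_sub_pow_mul (p := p) P hQ₁
    obtain ⟨r, rfl⟩ : ∃ r', r = r' + 1 := by
      refine Nat.exists_eq_succ_of_ne_zero ?_
      rintro rfl
      simp at hr
    -- The pole order is `m + 1 = p * (r + 1)`, so `d + 1 = (p - 1) * (r + 1)`. That this is
    -- positive makes `π` divide the correction term coming from `-h` below.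
    obtain ⟨d, hd⟩ : ∃ d, m + 1 = (r + 1) + (d + 1) := by
      obtain ⟨q, rfl⟩ : ∃ q, p = q + 2 := Nat.exists_eq_add_of_le' hpp.two_le
      exact ⟨(q + 1) * (r + 1) - 1, by
        have : 0 < (q + 1) * (r + 1) := by positivity
        rw [hr, Nat.sub_add_cancel this]; ring⟩
    obtain ⟨P', hP'⟩ : π ∣ P - w ^ p * Q₁ + w * π ^ (d + 1) * Q₁ :=
      dvd_add hw (dvd_mul_of_dvd_left (dvd_mul_of_dvd_right (dvd_pow_self _ d.succ_ne_zero) _) _)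
    have hπ0 := hne hπ.ne_zero
    -- Replacing `y` by `y - h` changes the numerator to `P - w ^ p * Q₁ + w * π ^ (d + 1) * Q₁`,
    -- from which one factor `π` cancels against the denominator.
    set h : Λ := aeval t w / aeval t π ^ (r + 1) with hh
    have hmem : h ∈ E⟮t⟯ :=
      div_mem (aeval_mem_adjoin_simple _) (pow_mem (aeval_mem_adjoin_simple _) _)
    have h1 : aeval t π ^ (m + 1) * h ^ p = aeval t w ^ p := by
      rw [hr, hh, div_pow, ← pow_mul, mul_comm p, mul_div_cancel₀ _ (pow_ne_zero _ hπ0)]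
    have h2 : aeval t π ^ (m + 1) * h = aeval t π ^ (d + 1) * aeval t w := by
      rw [hd, hh, pow_add]
      field_simp
    obtain ⟨h', hh', P'', hP''⟩ := ih _ hdeg (y - h) P' _ hQ' rfl (by
      refine mul_left_cancel₀ hπ0 ?_
      rw [← map_mul, ← hP', sub_pow_char]
      simp only [map_add, map_sub, map_mul, map_pow] at hyP ⊢
      linear_combination hyP - aeval t Q₁ * h1 + aeval t Q₁ * h2)
    exact ⟨h + h', add_mem hmem hh', P'', by rw [← hP'', sub_sub]⟩

/-- The pole at infinity of the right-hand side of a tame Artin-Schreier equation can be removed. -/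
theorem exists_sub_artinSchreier_eq_algebraMap (n : ℕ) : ∀ (y : Λ) (P : E[X]),
    P.natDegree = n → y ^ p - y = aeval (algebraMap (RatFunc F) Λ RatFunc.X) P →
    ∃ h ∈ E⟮algebraMap (RatFunc F) Λ RatFunc.X⟯, ∃ c : E,
      (y - h) ^ p - (y - h) = algebraMap E Λ c := by
  set t := algebraMap (RatFunc F) Λ RatFunc.X with ht
  have hpp : p.Prime := Fact.out
  have : CharP Λ p := charP_of_injective_algebraMap (algebraMap E Λ).injective p
  have : PerfectField E := Algebra.IsAlgebraic.perfectField F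
  have : ExpChar E p := .prime hpp
  induction n using Nat.strong_induction_on with
  | _ n ih =>
    intro y P hn hyP
    obtain rfl | hn0 := Nat.eq_zero_or_pos n
    · rw [eq_C_of_natDegree_eq_zero hn, aeval_C] at hyP
      exact ⟨0, zero_mem _, _, by rwa [sub_zero]⟩
    have hpn : p ∣ n := by
      obtain ⟨V, hE, hV⟩ := ValuationSubring.exists_one_lt_valuation
        (RatFunc.transcendental_algebraMap_X_of_isAlgebraic F E Λ)
      have hF : ∀ c : F, algebraMap F Λ c ∈ V := fun c => by
        rw [IsScalarTower.algebraMap_apply F E Λ]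
        exact hE _
      have hs := V.isBaseUniformizer_inv_X hF hV
      refine hs.dvd_of_artinSchreier hpp.one_lt
        (H V (V.ne_top_of_valuation_lt_one hs.ne_zero hs.lt_one) hF) hn0 (y := y) ?_
      rw [hyP, V.valuation_aeval_of_one_lt hE hV, hn, map_inv₀, inv_zpow', neg_neg, zpow_natCast]
      rintro rfl
      simp [← hn] at hn0
    obtain ⟨r, rfl⟩ := hpn
    obtain ⟨d, hd⟩ := surjective_frobenius E p P.leadingCoeff
    rw [frobenius_def] at hd
    have hr0 : 0 < r := Nat.pos_of_mul_pos_left hn0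
    have hlt : r < p * r := (Nat.lt_mul_iff_one_lt_left hr0).2 hpp.one_lt
    have hdeg : (P.eraseLead + C d * X ^ r).natDegree < p * r := by
      refine (natDegree_add_le _ _).trans_lt (max_lt ?_ ((natDegree_C_mul_X_pow_le _ _).trans_lt hlt))
      exact (eraseLead_natDegree_le _).trans_lt (by omega)
    -- The `p`-th power of `d * t ^ r` is the leading term of `P`; subtracting it costs only the
    -- term `d * t ^ r`, of lower degree.
    obtain ⟨h', hh', c, hc⟩ := ih _ hdeg (y - algebraMap E Λ d * t ^ r) _ rfl (by
      have h1 := congrArg (aeval t) P.eraseLead_add_C_mul_X_pow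
      rw [hn, ← hd] at h1
      rw [sub_pow_char]
      simp only [map_add, map_mul, aeval_C, aeval_X, map_pow] at h1 ⊢
      rw [← h1, pow_mul'] at hyP
      linear_combination hyP)
    exact ⟨_, add_mem (mul_mem (E⟮t⟯.algebraMap_mem d) (pow_mem (mem_adjoin_simple_self E t) r)) hh',
      c, by rw [← hc, sub_sub]⟩

theorem exists_isAlgebraic_sub_of_artinSchreier {y : Λ}
    (hy : y ^ p - y ∈ E⟮algebraMap (RatFunc F) Λ RatFunc.X⟯) :
    ∃ h ∈ E⟮algebraMap (RatFunc F) Λ RatFunc.X⟯, IsAlgebraic E (y - h) := by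
  have hpp : p.Prime := Fact.out
  obtain ⟨P, Q, hPQ⟩ := (mem_adjoin_simple_iff E _).1 hy
  obtain ⟨h₁, hh₁, P', hP'⟩ : ∃ h ∈ E⟮algebraMap (RatFunc F) Λ RatFunc.X⟯, ∃ P' : E[X],
      (y - h) ^ p - (y - h) = aeval (algebraMap (RatFunc F) Λ RatFunc.X) P' := by
    obtain rfl | hQ := eq_or_ne Q 0
    -- Division by zero gives zero, so here `y ^ p - y = 0`.
    · exact ⟨0, zero_mem _, 0, by simpa using hPQ⟩
    refine exists_sub_artinSchreier_eq_aeval H _ y P Q hQ rfl ?_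
    rw [hPQ, mul_div_cancel₀ _ (RatFunc.aeval_algebraMap_X_ne_zero F E Λ hQ)]
  obtain ⟨h₂, hh₂, c, hc⟩ := exists_sub_artinSchreier_eq_algebraMap H _ _ P' rfl hP'
  refine ⟨h₁ + h₂, add_mem hh₁ hh₂, X ^ p - X - C c, ?_, ?_⟩
  · have : (X ^ p - X - C c : E[X]).natDegree = p := by
      rw [natDegree_sub_C, natDegree_sub_eq_left_of_natDegree_lt] <;> simp [hpp.one_lt]
    rintro h0
    rw [h0] at this
    exact hpp.ne_zero (by simpa using this.symm)
  · simp only [map_sub, map_pow, aeval_X, aeval_C, ← sub_sub, hc, sub_self]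

end ArtinSchreier

/-! ### Kummer theory over a rational function field with algebraically closed constants -/

theorem ValuationSubring.IsBaseUniformizer.dvd_of_pow_mul_eq {k Λ : Type*} [Field k] [Field Λ]
    [Algebra k Λ] {V : ValuationSubring Λ} {s : Λ} (hs : V.IsBaseUniformizer k s) {l : ℕ} {z : Λˣ}
    (H : z ^ l ∈ V.baseValued k → z ∈ V.baseValued k) {u w : Λ} (h : (z : Λ) ^ l * u ^ l = w)
    {m n : ℤ} (hu : V.valuation u = V.valuation s ^ m) (hw : V.valuation w = V.valuation s ^ n) :
    (l : ℤ) ∣ n := by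
  have hs0 : V.valuation s ≠ 0 := (Valuation.ne_zero_iff _).2 hs.ne_zero
  have h1 : V.valuation (z : Λ) ^ l = V.valuation s ^ (n - m * l) := by
    rw [zpow_sub₀ hs0, zpow_mul, ← hu, ← hw, ← h, map_mul, map_pow, map_pow, zpow_natCast,
      mul_div_cancel_right₀]
    exact pow_ne_zero _ (hu ▸ zpow_ne_zero _ hs0)
  have h2 := hs.dvd_of_pow_eq (H (hs.mem_baseValued_of_eq_zpow (m := n - m * l)
    (by rw [Units.val_pow_eq_pow_val, map_pow, h1]))) h1
  exact (dvd_sub_left (dvd_mul_left _ _)).1 h2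

section Kummer

variable {F E Λ : Type*} [Field F] [Field E] [Field Λ] [Algebra F E] [Algebra E Λ] [Algebra F Λ]
  [IsScalarTower F E Λ] [Algebra (RatFunc F) Λ] [IsScalarTower F (RatFunc F) Λ]
  [PerfectField F] [Algebra.IsAlgebraic F E]

theorem dvd_rootMultiplicity_of_pow_mul_eq {l : ℕ} {z : Λˣ} (a : E)
    (H : ∀ V : ValuationSubring Λ, V ≠ ⊤ → (∀ c : E, algebraMap E Λ c ∈ V) →
      algebraMap (RatFunc F) Λ RatFunc.X ∈ V →
      V.valuation (aeval (algebraMap (RatFunc F) Λ RatFunc.X) (X - C a)) < 1 →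
      z ^ l ∈ V.baseValued (RatFunc F) → z ∈ V.baseValued (RatFunc F))
    {Q R : E[X]} (hQ : Q ≠ 0) (hR : R ≠ 0)
    (h : (z : Λ) ^ l * aeval (algebraMap (RatFunc F) Λ RatFunc.X) Q ^ l =
      aeval (algebraMap (RatFunc F) Λ RatFunc.X) R) :
    l ∣ R.rootMultiplicity a := by
  have hπ := irreducible_X_sub_C a
  obtain ⟨V, hE, htV, hV⟩ := exists_valuationSubring_valuation_aeval_lt_one
    (RatFunc.transcendental_algebraMap_X_of_isAlgebraic F E Λ) hπ.not_isUnit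
  have hs := V.isBaseUniformizer_aeval hE htV hπ hV
  have key : ∀ q : E[X], q ≠ 0 → V.valuation (aeval (algebraMap (RatFunc F) Λ RatFunc.X) q) =
      V.valuation (aeval (algebraMap (RatFunc F) Λ RatFunc.X) (X - C a)) ^
        (q.rootMultiplicity a : ℤ) := fun q hq => by
    obtain ⟨q', hq', hnd⟩ := exists_eq_pow_rootMultiplicity_mul_and_not_dvd q hq a
    conv_lhs => rw [hq']
    rw [V.valuation_aeval_of_lt_one hE htV hπ hV hnd, zpow_natCast]
  exact Int.natCast_dvd_natCast.1 (hs.dvd_of_pow_mul_eq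
    (H V (V.ne_top_of_valuation_lt_one hs.ne_zero hV) hE htV hV) h (key Q hQ) (key R hR))

omit [PerfectField F] in
theorem dvd_natDegree_of_pow_mul_eq {l : ℕ} {z : Λˣ}
    (H : ∀ V : ValuationSubring Λ, V ≠ ⊤ → (∀ c : E, algebraMap E Λ c ∈ V) →
      1 < V.valuation (algebraMap (RatFunc F) Λ RatFunc.X) →
      z ^ l ∈ V.baseValued (RatFunc F) → z ∈ V.baseValued (RatFunc F))
    {Q R : E[X]} (hQ : Q ≠ 0) (hR : R ≠ 0)
    (h : (z : Λ) ^ l * aeval (algebraMap (RatFunc F) Λ RatFunc.X) Q ^ l =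
      aeval (algebraMap (RatFunc F) Λ RatFunc.X) R) :
    l ∣ R.natDegree := by
  obtain ⟨V, hE, hV⟩ := ValuationSubring.exists_one_lt_valuation
    (RatFunc.transcendental_algebraMap_X_of_isAlgebraic F E Λ)
  have hs := V.isBaseUniformizer_inv_X (F := F) (fun c => by
    rw [IsScalarTower.algebraMap_apply F E Λ]
    exact hE _) hV
  have key : ∀ q : E[X], q ≠ 0 → V.valuation (aeval (algebraMap (RatFunc F) Λ RatFunc.X) q) =
      V.valuation (algebraMap (RatFunc F) Λ RatFunc.X)⁻¹ ^ (-q.natDegree : ℤ) := fun q hq => by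
    rw [V.valuation_aeval_of_one_lt hE hV hq, map_inv₀, inv_zpow', neg_neg, zpow_natCast]
  have := hs.dvd_of_pow_mul_eq
    (H V (V.ne_top_of_valuation_lt_one hs.ne_zero hs.lt_one) hE hV) h (key Q hQ) (key R hR)
  rwa [dvd_neg, Int.natCast_dvd_natCast] at this

theorem Polynomial.exists_eq_pow_of_dvd_rootMultiplicity {E : Type*} [Field E] [IsAlgClosed E]
    {l : ℕ} (hl : 0 < l) {R : E[X]} (h : ∀ a, l ∣ R.rootMultiplicity a) : ∃ g : E[X], R = g ^ l := by
  classical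
  obtain ⟨u, hu⟩ := Multiset.exists_smul_of_dvd_count R.roots (k := l) fun a _ => by
    rw [count_roots]
    exact h a
  obtain ⟨c, hc⟩ := IsAlgClosed.exists_pow_nat_eq R.leadingCoeff hl
  refine ⟨C c * (u.map fun a => X - C a).prod, ?_⟩
  rw [mul_pow, ← C_pow, hc, ← Multiset.prod_nsmul, ← Multiset.map_nsmul, ← hu]
  exact (IsAlgClosed.splits R).eq_prod_roots

/-- The multiplicities add up to the degree, so divisibility at all roots but one forces it at the
last. -/
theorem Polynomial.dvd_rootMultiplicity_of_dvd_natDegree {E : Type*} [Field E] [IsAlgClosed E]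
    {l : ℕ} {R : E[X]} (a : E) (h : ∀ b ≠ a, l ∣ R.rootMultiplicity b) (hd : l ∣ R.natDegree) :
    l ∣ R.rootMultiplicity a := by
  classical
  rw [← (IsAlgClosed.splits R).natDegree_eq_card_roots.symm, ← Multiset.toFinset_sum_count_eq] at hd
  by_cases ha : a ∈ R.roots.toFinset
  · rw [← Finset.add_sum_erase _ _ ha] at hd
    rw [← count_roots]
    refine (Nat.dvd_add_iff_left (Finset.dvd_sum fun b hb => ?_)).2 hd
    rw [count_roots]
    exact h b (Finset.ne_of_mem_erase hb)
  · rw [← count_roots, Multiset.count_eq_zero_of_notMem (by simpa using ha)]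
    exact dvd_zero l

/-- Kummer's criterion: an `l`-th root of a rational function with at most one zero or pole of order
not divisible by `l`, the latter of degree one, is rational. -/
theorem mem_adjoin_of_pow_mem_adjoin [IsAlgClosed E] {l : ℕ} (hl : 0 < l) {z : Λˣ}
    (H : (∀ V : ValuationSubring Λ, V ≠ ⊤ → (∀ c : E, algebraMap E Λ c ∈ V) →
        algebraMap (RatFunc F) Λ RatFunc.X ∈ V →
        z ^ l ∈ V.baseValued (RatFunc F) → z ∈ V.baseValued (RatFunc F)) ∨
      ∃ a : E, ∀ V : ValuationSubring Λ, V ≠ ⊤ → (∀ c : E, algebraMap E Λ c ∈ V) →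
        1 ≤ V.valuation (aeval (algebraMap (RatFunc F) Λ RatFunc.X) (X - C a)) →
        z ^ l ∈ V.baseValued (RatFunc F) → z ∈ V.baseValued (RatFunc F))
    (hz : (z : Λ) ^ l ∈ E⟮algebraMap (RatFunc F) Λ RatFunc.X⟯) :
    (z : Λ) ∈ E⟮algebraMap (RatFunc F) Λ RatFunc.X⟯ := by
  set t := algebraMap (RatFunc F) Λ RatFunc.X with ht
  have hne : ∀ {q : E[X]}, q ≠ 0 → aeval t q ≠ 0 :=
    fun h => RatFunc.aeval_algebraMap_X_ne_zero F E Λ h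
  obtain ⟨P, Q, hPQ⟩ := (mem_adjoin_simple_iff E _).1 hz
  have hz0 : (z : Λ) ^ l ≠ 0 := pow_ne_zero _ z.ne_zero
  have hQ : Q ≠ 0 := by
    rintro rfl
    simp [hPQ] at hz0
  have hP : P ≠ 0 := by
    rintro rfl
    simp [hPQ] at hz0
  -- `z ^ l = P / Q` becomes `(z * Q) ^ l = R`, so only zeros of a polynomial remain to be studied.
  obtain ⟨R, hR⟩ : ∃ R, R = P * Q ^ (l - 1) := ⟨_, rfl⟩
  have hR0 : R ≠ 0 := hR ▸ mul_ne_zero hP (pow_ne_zero _ hQ)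
  have h : (z : Λ) ^ l * aeval t Q ^ l = aeval t R := by
    have hQ' := hne hQ
    obtain ⟨l, rfl⟩ := Nat.exists_eq_succ_of_ne_zero hl.ne'
    rw [hPQ, hR, map_mul, map_pow, pow_succ, Nat.succ_sub_one]
    field_simp
  have hmult : ∀ a, l ∣ R.rootMultiplicity a := by
    obtain H | ⟨a, H⟩ := H
    · exact fun a => dvd_rootMultiplicity_of_pow_mul_eq a
        (fun V h1 h2 h3 _ => H V h1 h2 h3) hQ hR0 h
    · have hb : ∀ b ≠ a, l ∣ R.rootMultiplicity b := fun b hba =>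
        dvd_rootMultiplicity_of_pow_mul_eq b (fun V h1 h2 h3 h4 => H V h1 h2
          (V.valuation_aeval_eq_one_of_isCoprime h2 h3 h4
            (isCoprime_X_sub_C_of_isUnit_sub (sub_ne_zero.2 hba).isUnit)).ge) hQ hR0 h
      intro b
      by_cases hba : b = a
      -- The place at infinity is not the exceptional one, so it shows that `l` divides the degree
      -- of `R`.
      · subst hba
        refine dvd_rootMultiplicity_of_dvd_natDegree b hb (dvd_natDegree_of_pow_mul_eq
          (fun V h1 h2 h3 => H V h1 h2 ?_) hQ hR0 h)
        rw [V.valuation_aeval_of_one_lt h2 h3 (X_sub_C_ne_zero b)]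
        exact one_le_pow₀ h3.le
      · exact hb b hba
  obtain ⟨g, rfl⟩ := exists_eq_pow_of_dvd_rootMultiplicity hl hmult
  have hg0 : aeval t g ≠ 0 := hne fun h0 => hR0 (by rw [h0, zero_pow hl.ne'])
  -- A root of unity is integral over the algebraically closed field `E`, hence a constant.
  have h1 : ((z : Λ) * aeval t Q / aeval t g) ^ l = 1 := by
    rw [div_pow, mul_pow, h, map_pow, div_self (pow_ne_zero _ hg0)]
  have hint : IsIntegral E ((z : Λ) * aeval t Q / aeval t g) :=
    .of_pow hl (h1 ▸ isIntegral_one)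
  obtain ⟨c, hc⟩ := minpoly.mem_range_of_degree_eq_one E _
    (IsAlgClosed.degree_eq_one_of_irreducible E (minpoly.irreducible hint))
  have h2 : (z : Λ) = algebraMap E Λ c * aeval t g / aeval t Q := by
    rw [hc, div_mul_cancel₀ _ hg0, mul_div_cancel_right₀ _ (hne hQ)]
  rw [h2]
  exact div_mem (mul_mem (E⟮t⟯.algebraMap_mem c) (aeval_mem_adjoin_simple _))
    (aeval_mem_adjoin_simple _)

end Kummer

/-! ### Values of algebraic elements, fixed elements, and subextensions of prime degree -/

/-- Terms summing to zero cannot have a unique one of maximal value. Two terms of the minimal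
equation of `z` with equal value give the power, `j` being the difference of their exponents. -/
theorem IsAlgebraic.exists_pow_mem_baseValued {K Λ : Type*} [Field K] [Field Λ] [Algebra K Λ]
    (V : ValuationSubring Λ) {z : Λˣ} (hz : IsAlgebraic K (z : Λ)) :
    ∃ j, 0 < j ∧ j ≤ (minpoly K (z : Λ)).natDegree ∧ z ^ j ∈ V.baseValued K := by
  classical
  set P := minpoly K (z : Λ)
  have hP : P ≠ 0 := minpoly.ne_zero hz.isIntegral
  have hterm : ∀ i ∈ P.support, V.valuation (algebraMap K Λ (P.coeff i) * (z : Λ) ^ i) ≠ 0 :=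
    fun i hi => (Valuation.ne_zero_iff _).2 (mul_ne_zero
      ((_root_.map_ne_zero _).2 (mem_support_iff.1 hi)) (pow_ne_zero _ z.ne_zero))
  obtain ⟨n, hn, hmax⟩ := P.support.exists_max_image
    (fun i => V.valuation (algebraMap K Λ (P.coeff i) * (z : Λ) ^ i)) (support_nonempty.2 hP)
  have hsum : ∑ i ∈ P.support, algebraMap K Λ (P.coeff i) * (z : Λ) ^ i = 0 := by
    have := minpoly.aeval K (z : Λ)
    rwa [aeval_def, eval₂_eq_sum, sum_def] at this
  obtain ⟨m, hm, hmn, heq⟩ : ∃ m ∈ P.support, m ≠ n ∧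
      V.valuation (algebraMap K Λ (P.coeff m) * (z : Λ) ^ m) =
        V.valuation (algebraMap K Λ (P.coeff n) * (z : Λ) ^ n) := by
    by_contra! h
    have hlt := V.valuation.map_sum_lt (hterm n hn) (s := P.support.erase n)
      (f := fun i => algebraMap K Λ (P.coeff i) * (z : Λ) ^ i) fun i hi =>
      lt_of_le_of_ne (hmax i (Finset.mem_of_mem_erase hi))
        (h i (Finset.mem_of_mem_erase hi) (Finset.ne_of_mem_erase hi))
    have h1 := Valuation.map_add_eq_of_lt_left _ hlt
    rw [Finset.add_sum_erase _ (fun i => algebraMap K Λ (P.coeff i) * (z : Λ) ^ i) hn, hsum,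
      map_zero] at h1
    exact hterm n hn h1.symm
  wlog hlt : m < n generalizing m n
  · refine this m hm (fun i hi => (hmax i hi).trans heq.ge) n hn hmn.symm heq.symm
      (lt_of_le_of_ne (not_lt.1 hlt) hmn.symm)
  refine ⟨n - m, Nat.sub_pos_of_lt hlt, (Nat.sub_le _ _).trans (le_natDegree_of_mem_supp n hn), ?_⟩
  refine ValuationSubring.mem_baseValued_iff.2 ⟨P.coeff m / P.coeff n, ?_⟩
  have hcn : V.valuation (algebraMap K Λ (P.coeff n)) ≠ 0 := by
    simpa using mem_support_iff.1 hn
  have hz0 : V.valuation (z : Λ) ≠ 0 := by simp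
  rw [map_div₀, map_div₀, eq_div_iff hcn]
  refine mul_right_cancel₀ (pow_ne_zero m hz0) ?_
  rw [map_mul, map_mul, map_pow, map_pow] at heq
  rw [heq, Units.val_pow_eq_pow_val, map_pow, mul_right_comm, ← pow_add,
    Nat.sub_add_cancel hlt.le, mul_comm]

theorem mem_range_algebraMap_of_forall_algEquiv {K Ω : Type*} [Field K] [Field Ω] [Algebra K Ω]
    [Normal K Ω] {x : Ω} (hx : IsSeparable K x) (h : ∀ s : Ω ≃ₐ[K] Ω, s x = x) :
    x ∈ (algebraMap K Ω).range := by
  have hint := hx.isIntegral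
  have hirr := minpoly.irreducible hint
  refine minpoly.mem_range_of_degree_eq_one K x ?_
  have hsplit := Normal.splits (F := K) inferInstance x
  have hcard : ((minpoly K x).map (algebraMap K Ω)).roots.card = (minpoly K x).natDegree := by
    rw [← hsplit.natDegree_eq_card_roots, natDegree_map]
  have hnodup : ((minpoly K x).map (algebraMap K Ω)).roots.Nodup := nodup_roots (Separable.map hx)
  have hroots : ((minpoly K x).map (algebraMap K Ω)).roots ≤ {x} := by
    refine (Multiset.le_iff_subset hnodup).2 fun y hy => ?_
    have hy' : aeval y (minpoly K x) = 0 := by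
      rw [mem_roots', IsRoot.def, eval_map_algebraMap] at hy
      exact hy.2
    obtain ⟨s, hs⟩ := minpoly.exists_algEquiv_of_root' (hint.isAlgebraic) hy'
    rw [Multiset.mem_singleton, ← hs, h]
  have h1 := Multiset.card_le_card hroots
  rw [hcard, Multiset.card_singleton] at h1
  have h2 := hirr.natDegree_pos
  rw [degree_eq_natDegree hirr.ne_zero, le_antisymm h1 h2]
  rfl

/-- Take a maximal subgroup: an element of prime order in the quotient must generate the whole
quotient. -/
theorem exists_subgroup_index_prime (G : Type*) [CommGroup G] [Finite G] [Nontrivial G] :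
    ∃ H : Subgroup G, H.index.Prime := by
  obtain ⟨H, hH, -⟩ := (eq_top_or_exists_le_coatom (⊥ : Subgroup G)).resolve_left bot_ne_top
  refine ⟨H, ?_⟩
  obtain ⟨q, hq, hqd⟩ := Nat.exists_prime_and_dvd (n := H.index)
    (fun h => hH.1 (Subgroup.index_eq_one.1 h))
  have : Fact q.Prime := ⟨hq⟩
  obtain ⟨g, hg⟩ := exists_prime_orderOf_dvd_card' (G := G ⧸ H) q hqd
  have htop : (Subgroup.zpowers g).comap (QuotientGroup.mk' H) = ⊤ := by
    refine hH.2 _ (lt_of_le_of_ne ?_ ?_)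
    · intro x hx
      rw [Subgroup.mem_comap, QuotientGroup.mk'_apply, (QuotientGroup.eq_one_iff x).2 hx]
      exact one_mem _
    · intro h
      obtain ⟨x, rfl⟩ := QuotientGroup.mk'_surjective H g
      have hx : x ∈ H := by
        rw [h]
        exact Subgroup.mem_zpowers _
      rw [QuotientGroup.mk'_apply, (QuotientGroup.eq_one_iff x).2 hx, orderOf_one] at hg
      exact hq.one_lt.ne hg
  have htop' : Subgroup.zpowers g = ⊤ := by
    rw [← Subgroup.map_comap_eq_self_of_surjective (QuotientGroup.mk'_surjective H)
      (Subgroup.zpowers g), htop, ← MonoidHom.range_eq_map,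
      MonoidHom.range_eq_top.2 (QuotientGroup.mk'_surjective H)]
  rw [Subgroup.index, ← Subgroup.card_top, ← htop', Nat.card_zpowers, hg]
  exact hq

open scoped IsMulCommutative in
/-- A nontrivial abelian extension has a subextension of prime degree. -/
theorem IsAbelianGalois.exists_intermediateField_finrank_prime {M L : Type*} [Field M] [Field L]
    [Algebra M L] [IsAbelianGalois M L] {x : L} (hx : x ∉ (⊥ : IntermediateField M L)) :
    ∃ N : IntermediateField M L, (Module.finrank M N).Prime := by
  have hint : IsIntegral M x := Algebra.IsIntegral.isIntegral x
  have : FiniteDimensional M M⟮x⟯ := adjoin.finiteDimensional hint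
  have : Nontrivial Gal(M⟮x⟯/M) := by
    rw [← Finite.one_lt_card_iff_nontrivial, IsGalois.card_aut_eq_finrank]
    refine lt_of_le_of_ne Module.finrank_pos fun h => hx ?_
    exact finrank_adjoin_simple_eq_one_iff.1 h.symm
  obtain ⟨H, hH⟩ := exists_subgroup_index_prime Gal(M⟮x⟯/M)
  refine ⟨lift (fixedField H), ?_⟩
  rw [← (liftAlgEquiv (fixedField H)).toLinearEquiv.finrank_eq,
    finrank_eq_fixingSubgroup_index, fixingSubgroup_fixedField]
  exact hH

theorem Function.Periodic.sum_range_add {A : Type*} [AddCommGroup A] {f : ℕ → A} {l : ℕ}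
    (hf : Function.Periodic f l) (c : ℕ) :
    ∑ i ∈ Finset.range l, f (i + c) = ∑ i ∈ Finset.range l, f i := by
  induction c with
  | zero => rfl
  | succ c ih =>
    have h := Finset.sum_range_succ' (fun i => f (i + c)) l
    rw [Finset.sum_range_succ, zero_add, add_comm l c, hf c] at h
    rw [← ih, add_right_cancel h]
    simp only [add_assoc, add_comm 1 c]

/-! ### Galois extensions of prime degree: Artin-Schreier generators and Lagrange resolvents -/

section PrimeDegree

variable {M N : Type*} [Field M] [Field N] [Algebra M N] [FiniteDimensional M N] [IsGalois M N]

theorem IsGalois.exists_generator_of_finrank_prime (h : (Module.finrank M N).Prime) :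
    ∃ σ : Gal(N/M), orderOf σ = Module.finrank M N ∧ ∀ g, g ∈ Subgroup.zpowers σ := by
  have hc := IsGalois.card_aut_eq_finrank M N
  have : Fact (Module.finrank M N).Prime := ⟨h⟩
  have : IsCyclic Gal(N/M) := isCyclic_of_prime_card hc
  obtain ⟨σ, hσ⟩ := IsCyclic.exists_generator (α := Gal(N/M))
  exact ⟨σ, by rw [orderOf_eq_card_of_forall_mem_zpowers hσ, hc], hσ⟩

theorem IsGalois.mem_range_of_generator_fixed {σ : Gal(N/M)}
    (hσ : ∀ g, g ∈ Subgroup.zpowers σ) {x : N} (hx : σ x = x) : x ∈ (algebraMap M N).range := by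
  have := (IsGalois.mem_bot_iff_fixed (F := M) x).2 fun g => by
    have hle : Subgroup.zpowers σ ≤ MulAction.stabilizer Gal(N/M) x :=
      Subgroup.zpowers_le.2 hx
    exact hle (hσ g)
  exact IntermediateField.mem_bot.1 this

/-- A Galois extension of prime degree `p` in characteristic `p` is generated by the roots of an
Artin-Schreier polynomial. -/
theorem IsGalois.exists_artinSchreier {p : ℕ} [hp : Fact p.Prime] [CharP N p]
    (h : Module.finrank M N = p) :
    ∃ y : N, y ∉ (algebraMap M N).range ∧ y ^ p - y ∈ (algebraMap M N).range := by
  classical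
  obtain ⟨σ, hord, hσ⟩ := exists_generator_of_finrank_prime (M := M) (N := N) (h ▸ hp.out)
  rw [h] at hord
  obtain ⟨x, hx⟩ := Algebra.trace_surjective M N 1
  have hσp : σ ^ p = 1 := hord ▸ pow_orderOf_eq_one σ
  have htr : ∑ i ∈ Finset.range p, (σ ^ i) x = 1 := by
    have h1 := trace_eq_sum_automorphisms (K := M) x
    rw [hx, map_one, ← IsCyclic.image_range_orderOf hσ, hord, Finset.sum_image] at h1
    · exact h1.symm
    · rw [Finset.coe_range, ← hord]
      exact pow_injOn_Iio_orderOf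
  -- As `x` has trace one, `σ S = S - 1`; so `S` is not in `M`, while `σ` fixes `S ^ p - S`.
  set S := ∑ i ∈ Finset.range p, (i : N) * (σ ^ i) x with hS
  have hσS : σ S = S - 1 := by
    have h1 : ∑ i ∈ Finset.range p, ((i + 1 : ℕ) : N) * (σ ^ (i + 1)) x = S := by
      have := Finset.sum_range_succ' (fun i : ℕ => (i : N) * (σ ^ i) x) p
      rw [Finset.sum_range_succ] at this
      rw [CharP.cast_eq_zero, zero_mul, add_zero, Nat.cast_zero, zero_mul, add_zero] at this
      exact this.symm
    have h2 : ∑ i ∈ Finset.range p, (σ ^ (i + 1)) x = 1 := by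
      have := Finset.sum_range_succ' (fun i : ℕ => (σ ^ i) x) p
      rw [Finset.sum_range_succ, htr, hσp, pow_zero] at this
      exact (add_right_cancel this).symm
    rw [hS, map_sum, ← hS, ← h1, ← h2, ← Finset.sum_sub_distrib]
    refine Finset.sum_congr rfl fun i _ => ?_
    rw [map_mul, map_natCast, pow_succ' σ i, AlgEquiv.mul_apply]
    push_cast
    ring
  refine ⟨S, ?_, mem_range_of_generator_fixed hσ ?_⟩
  · rintro ⟨c, hc⟩
    rw [← hc, AlgEquiv.commutes] at hσS
    exact one_ne_zero (sub_eq_self.1 hσS.symm)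
  · rw [map_sub, map_pow, hσS, sub_pow_char, one_pow]
    ring

variable {Ω : Type*} [Field Ω] [Algebra N Ω] [Algebra M Ω] [IsScalarTower M N Ω]

/-- The Lagrange resolvents of an element of a Galois extension of prime degree. -/
theorem IsGalois.exists_lagrangeResolvents [Normal M Ω] (h : (Module.finrank M N).Prime) {ζ : Ω}
    (hζ : IsPrimitiveRoot ζ (Module.finrank M N)) (y : N) :
    ∃ θ : ℕ → Ω, (∀ j, θ j ∈ N⟮ζ⟯) ∧ (∀ j, θ j ^ Module.finrank M N ∈ M⟮ζ⟯) ∧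
      ∑ j ∈ Finset.range (Module.finrank M N), θ j = (Module.finrank M N : Ω) * algebraMap N Ω y := by
  obtain ⟨σ, hord, hσ⟩ := exists_generator_of_finrank_prime h
  set l := Module.finrank M N with hl
  have hσl : σ ^ l = 1 := hord ▸ pow_orderOf_eq_one σ
  refine ⟨fun j => ∑ i ∈ Finset.range l, ζ ^ (i * j) * algebraMap N Ω ((σ ^ i) y),
    fun j => ?_, fun j => ?_, ?_⟩
  · exact sum_mem fun i _ => mul_mem (pow_mem (mem_adjoin_simple_self N ζ) _)
      (N⟮ζ⟯.algebraMap_mem _)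
  · set θ := ∑ i ∈ Finset.range l, ζ ^ (i * j) * algebraMap N Ω ((σ ^ i) y) with hθ
    have hsep : ∀ n : N, IsSeparable M⟮ζ⟯ (algebraMap N Ω n) := fun n =>
      ((Algebra.IsSeparable.isSeparable M n).map (algebraMap N Ω).injective
        (f := IsScalarTower.toAlgHom M N Ω)).tower_top _
    have : Normal M⟮ζ⟯ Ω := Normal.tower_top_of_normal M _ Ω
    suffices hmem : θ ^ l ∈ (algebraMap M⟮ζ⟯ Ω).range by
      obtain ⟨w, hw⟩ := hmem
      exact hw ▸ w.2
    refine mem_range_algebraMap_of_forall_algEquiv ?_ ?_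
    · rw [← mem_separableClosure_iff]
      refine pow_mem (sum_mem fun i _ => mul_mem (pow_mem ?_ _) ?_) _
      · exact (separableClosure M⟮ζ⟯ Ω).algebraMap_mem (AdjoinSimple.gen M ζ)
      · exact mem_separableClosure_iff.2 (hsep _)
    · intro s
      have hsζ : s ζ = ζ := s.commutes (AdjoinSimple.gen M ζ)
      obtain ⟨c, hc⟩ : ∃ c : ℕ, σ ^ c = (s.restrictScalars M).restrictNormal N := by
        exact (isOfFinOrder_of_finite σ).mem_powers_iff_mem_zpowers.2 (hσ _)
      have hs : ∀ n : N, s (algebraMap N Ω n) = algebraMap N Ω ((σ ^ c) n) := fun n => by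
        rw [hc, AlgEquiv.restrictNormal_commutes]
        rfl
      -- An automorphism fixing `M` and `ζ` acts on `N` as some `σ ^ c`, so it changes the resolvent
      -- only by an `l`-th root of unity.
      have hstep : ζ ^ (c * j) * s θ = θ := by
        rw [hθ, map_sum, Finset.mul_sum, ← Function.Periodic.sum_range_add
          (f := fun i => ζ ^ (i * j) * algebraMap N Ω ((σ ^ i) y)) (fun i => ?_) c]
        · refine Finset.sum_congr rfl fun i _ => ?_
          rw [map_mul, map_pow, hsζ, hs, ← AlgEquiv.mul_apply, ← pow_add, add_comm c i]
          ring
        · simp only [pow_add, add_mul, hσl, mul_one]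
          rw [pow_mul ζ l, hζ.pow_eq_one, one_pow, mul_one]
      have hζ1 : (ζ ^ (c * j)) ^ l = 1 := by rw [← pow_mul, mul_comm, pow_mul, hζ.pow_eq_one, one_pow]
      rw [map_pow]
      conv_rhs => rw [← hstep, mul_pow, hζ1, one_mul]
  · rw [Finset.sum_comm, Finset.sum_eq_single 0]
    · simp
    · intro i hi hi0
      rw [← Finset.sum_mul]
      have h1 : (ζ ^ i - 1) * ∑ j ∈ Finset.range l, ζ ^ (i * j) = 0 := by
        simp_rw [pow_mul]
        rw [mul_geom_sum, ← pow_mul, mul_comm i, pow_mul, hζ.pow_eq_one, one_pow, sub_self]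
      rw [(mul_eq_zero.1 h1).resolve_left (sub_ne_zero.2
        (hζ.pow_ne_one_of_pos_of_lt hi0 (Finset.mem_range.1 hi))), zero_mul]
    · intro h0
      exact absurd (Finset.mem_range.2 h.pos) h0

end PrimeDegree

/-! ### Restriction of valuation rings, tameness and unramified places -/

section Comap

variable {K Λ : Type*} [Field K] [Field Λ] [Algebra K Λ]

theorem ValuationSubring.comap_valuation_eq_iff (V : ValuationSubring Λ) {x y : K} :
    (V.comap (algebraMap K Λ)).valuation x = (V.comap (algebraMap K Λ)).valuation y ↔
      V.valuation (algebraMap K Λ x) = V.valuation (algebraMap K Λ y) := by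
  have key : ∀ x y : K,
      (V.comap (algebraMap K Λ)).valuation x ≤ (V.comap (algebraMap K Λ)).valuation y ↔
        V.valuation (algebraMap K Λ x) ≤ V.valuation (algebraMap K Λ y) := fun x y => by
    obtain rfl | hy := eq_or_ne y 0
    · simp
    · have h1 : (V.comap (algebraMap K Λ)).valuation y ≠ 0 := by simpa using hy
      have h2 : V.valuation (algebraMap K Λ y) ≠ 0 := by simpa using hy
      rw [← div_le_one₀ (zero_lt_iff.2 h1), ← div_le_one₀ (zero_lt_iff.2 h2), ← map_div₀,
        ← map_div₀, ← map_div₀, valuation_le_one_iff, valuation_le_one_iff, mem_comap]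
  rw [le_antisymm_iff, le_antisymm_iff, key, key]

/-- Some positive power of each nonzero `x` has the value of an element of `K`; if `V` contains `K`,
that value is at most one, and so is that of `x`. -/
theorem ValuationSubring.comap_ne_top [Algebra.IsAlgebraic K Λ] {V : ValuationSubring Λ}
    (hV : V ≠ ⊤) : V.comap (algebraMap K Λ) ≠ ⊤ := by
  intro h
  refine hV (SetLike.ext fun x => iff_of_true ?_ (mem_top x))
  obtain rfl | hx := eq_or_ne x 0
  · exact zero_mem _
  obtain ⟨j, hj, -, hxj⟩ := IsAlgebraic.exists_pow_mem_baseValued V (z := Units.mk0 x hx)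
    (Algebra.IsAlgebraic.isAlgebraic (R := K) _)
  obtain ⟨b, hb⟩ := mem_baseValued_iff.1 hxj
  have hle : ∀ c : K, V.valuation (algebraMap K Λ c) ≤ 1 := fun c =>
    (V.valuation_le_one_iff _).2 (mem_comap.1 (h ▸ mem_top c))
  rw [Units.val_pow_eq_pow_val, map_pow, Units.val_mk0] at hb
  rw [← valuation_le_one_iff]
  exact (pow_le_one_iff_of_nonneg zero_le hj.ne').1 (hb ▸ hle b)

end Comap

namespace PrimeDivisor

theorem ringChar_residueField {F L : Type*} [Field F] [Field L] [Algebra F L]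
    (Q : PrimeDivisor F L) (p : ℕ) [CharP F p] :
    ringChar (IsLocalRing.ResidueField Q.ring) = p := by
  have : CharP (IsLocalRing.ResidueField Q.ring) p :=
    charP_of_injective_algebraMap (algebraMap F (IsLocalRing.ResidueField Q.ring)).injective p
  exact ringChar.eq (IsLocalRing.ResidueField Q.ring) p

theorem IsTameOver.mem_unitsMulBase {F K L : Type*} [Field F] [Field K] [Field L] [Algebra F L]
    [Algebra K L] {Q : PrimeDivisor F L} (hQ : Q.IsTameOver K) {p : ℕ} (hp : p.Prime) [CharP F p]
    {z : Lˣ} (hz : z ^ p ∈ Q.unitsMulBase K) : z ∈ Q.unitsMulBase K := by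
  have h1 : orderOf (z : Lˣ ⧸ Q.unitsMulBase K) ∣ p := by
    rw [orderOf_dvd_iff_pow_eq_one, ← QuotientGroup.mk_pow]
    exact (QuotientGroup.eq_one_iff _).2 hz
  obtain h2 | h2 := (Nat.dvd_prime hp).1 h1
  · exact (QuotientGroup.eq_one_iff _).1 (orderOf_eq_one_iff.1 h2)
  · refine absurd ?_ (hQ (z : Lˣ ⧸ Q.unitsMulBase K))
    rw [Q.ringChar_residueField p, h2]

theorem exists_sub_mem_nonunits_of_degree_eq_one {F K : Type*} [Field F] [Field K] [Algebra F K]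
    {P : PrimeDivisor F K} (hP : P.degree = 1) {x : K} (hx : x ∈ P.ring) :
    ∃ a : F, x - algebraMap F K a ∈ P.ring.nonunits := by
  obtain ⟨a, ha⟩ := (Algebra.finrank_eq_one_iff_bijective_algebraMap.1 hP).2
    (IsLocalRing.residue P.ring ⟨x, hx⟩)
  refine ⟨a, ?_⟩
  have h1 : IsLocalRing.residue P.ring (⟨x, hx⟩ - algebraMap F P.ring a) = 0 := by
    rw [map_sub, ← ha, sub_eq_zero]
    rfl
  rw [IsLocalRing.residue_eq_zero_iff] at h1
  exact ValuationSubring.coe_mem_nonunits_iff.2 h1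

end PrimeDivisor

/-- A valuation ring over `L` whose restriction to `K` is unramified in `L` takes on `L` only values
that it takes on `K`. -/
theorem ValuationSubring.baseValued_le_of_forall_isRamifiedIn {F K L Ω : Type*} [Field F] [Field K]
    [Field L] [Field Ω] [Algebra F K] [Algebra F L] [Algebra K L] [Algebra L Ω] [Algebra K Ω]
    [Algebra F Ω] [IsScalarTower F K L] [IsScalarTower K L Ω] [IsScalarTower F L Ω]
    [Algebra.IsAlgebraic K L] [Algebra.IsAlgebraic L Ω] {p₀ : PrimeDivisor F K}
    (hram : ∀ P : PrimeDivisor F K, P.IsRamifiedIn L → P = p₀) {V : ValuationSubring Ω}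
    (hV : V ≠ ⊤) (hF : ∀ c : F, algebraMap F Ω c ∈ V)
    (hne : V.comap (algebraMap K Ω) ≠ p₀.ring) : V.baseValued L ≤ V.baseValued K := by
  let Q : PrimeDivisor F L := ⟨V.comap (algebraMap L Ω), comap_ne_top hV, fun c => by
    rw [mem_comap, ← IsScalarTower.algebraMap_apply]
    exact hF c⟩
  let P : PrimeDivisor F K := ⟨Q.ring.comap (algebraMap K L), comap_ne_top Q.ne_top, fun c => by
    rw [mem_comap, ← IsScalarTower.algebraMap_apply]
    exact Q.algebraMap_mem c⟩
  have hP : P ≠ p₀ := by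
    rintro h
    refine hne ?_
    rw [← h]
    change _ = (V.comap (algebraMap L Ω)).comap (algebraMap K L)
    rw [comap_comap, ← IsScalarTower.algebraMap_eq]
  have htop : Q.unitsMulBase K = ⊤ := by
    by_contra h
    exact hP (hram P ⟨Q, fun x => Iff.rfl, fun h1 => h (Subgroup.index_eq_one.1 h1)⟩)
  intro z hz
  obtain ⟨b, hb⟩ := mem_baseValued_iff.1 hz
  have hb0 : b ≠ 0 := by
    rintro rfl
    simp at hb
  have hbQ : Units.mk0 b hb0 ∈ Q.ring.baseValued K := by
    change _ ∈ Q.unitsMulBase K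
    rw [htop]
    trivial
  obtain ⟨c, hc⟩ := mem_baseValued_iff.1 hbQ
  refine mem_baseValued_iff.2 ⟨c, ?_⟩
  rw [hb, IsScalarTower.algebraMap_apply K L Ω]
  exact (V.comap_valuation_eq_iff).1 hc

/-! ### Descent of rational functions from algebraic constants to `L` -/

section Adjoin

variable {F L Ω : Type*} [Field F] [Field L] [Field Ω] [Algebra F L] [Algebra L Ω]
  [Algebra F Ω] [IsScalarTower F L Ω] [Algebra (RatFunc F) L] [Algebra (RatFunc F) Ω]
  [IsScalarTower (RatFunc F) L Ω] [IsScalarTower F (RatFunc F) Ω]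

omit [Algebra F L] [IsScalarTower F L Ω] in
theorem algebraMap_mem_adjoin_X_of_mem_adjoin {C : Type*} [Field C] [Algebra F C] [Algebra C Ω]
    [IsScalarTower F C Ω] {S : Set L} (hS : ∀ e ∈ S, algebraMap L Ω e ∈ (algebraMap C Ω).range)
    {u : L} (hu : u ∈ adjoin (RatFunc F) S) :
    algebraMap L Ω u ∈ C⟮algebraMap (RatFunc F) Ω RatFunc.X⟯ := by
  induction hu using adjoin_induction with
  | mem e he =>
    obtain ⟨c, hc⟩ := hS e he
    rw [← hc]
    exact IntermediateField.algebraMap_mem _ c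
  | algebraMap b =>
    rw [← IsScalarTower.algebraMap_apply]
    obtain rfl | hb := eq_or_ne b 0
    · rw [map_zero]
      exact zero_mem _
    · obtain ⟨p, q, -, -, h⟩ := RatFunc.exists_algebraMap_eq_div (Λ := Ω) b hb
      rw [h, ← aeval_map_algebraMap C _ p, ← aeval_map_algebraMap C _ q]
      exact div_mem (aeval_mem_adjoin_simple _) (aeval_mem_adjoin_simple _)
  | add x y _ _ hx hy =>
    rw [map_add]
    exact add_mem hx hy
  | inv x _ hx =>
    rw [map_inv₀]
    exact inv_mem hx
  | mul x y _ _ hx hy =>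
    rw [map_mul]
    exact mul_mem hx hy

theorem mem_adjoin_of_mem_adjoin_X {S : IntermediateField F L} {u : L}
    (hu : u ∈ S⟮algebraMap (RatFunc F) L RatFunc.X⟯) : u ∈ adjoin (RatFunc F) (S : Set L) := by
  have key : ∀ q : S[X], aeval (algebraMap (RatFunc F) L RatFunc.X) q ∈
      adjoin (RatFunc F) (S : Set L) := fun q => by
    rw [aeval_eq_sum_range]
    refine sum_mem fun i _ => ?_
    rw [Algebra.smul_def]
    exact mul_mem (subset_adjoin _ _ (q.coeff i).2)
      (pow_mem (IntermediateField.algebraMap_mem _ _) _)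
  obtain ⟨p, q, rfl⟩ := (mem_adjoin_simple_iff S u).1 hu
  exact div_mem (key p) (key q)

variable [PerfectField F] [IsAlgClosed Ω] [Normal L Ω]

omit [IsScalarTower F (RatFunc F) Ω] [IsAlgClosed Ω] in
-- The coefficients are separable over `F`, which is perfect, so being fixed by all automorphisms
-- over `L` puts them in `L`, as constants.
theorem exists_mem_adjoin_algebraMap_eq_aeval {q : (algebraicClosure F Ω)[X]}
    (hq : ∀ (s : Ω ≃ₐ[L] Ω) (i : ℕ), s (q.coeff i : Ω) = q.coeff i) :
    ∃ u ∈ adjoin (RatFunc F) (algebraicClosure F L : Set L),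
      algebraMap L Ω u = aeval (algebraMap (RatFunc F) Ω RatFunc.X) q := by
  suffices h : aeval (algebraMap (RatFunc F) Ω RatFunc.X) q ∈
      (adjoin (RatFunc F) (algebraicClosure F L : Set L)).map
        (IsScalarTower.toAlgHom (RatFunc F) L Ω) from h
  rw [aeval_eq_sum_range]
  refine sum_mem fun i _ => ?_
  rw [Algebra.smul_def]
  refine mul_mem ?_ (pow_mem (IntermediateField.algebraMap_mem _ _) _)
  have halg : IsAlgebraic F (q.coeff i : Ω) := mem_algebraicClosure_iff.1 (q.coeff i).2
  have hsep : IsSeparable F (q.coeff i : Ω) :=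
    PerfectField.separable_of_irreducible (minpoly.irreducible halg.isIntegral)
  obtain ⟨e, he⟩ := mem_range_algebraMap_of_forall_algEquiv (hsep.tower_top L) fun s => hq s i
  refine ⟨e, subset_adjoin _ _ (mem_algebraicClosure_iff.2 ?_), he⟩
  rw [← he] at halg
  exact (isAlgebraic_algebraMap_iff (algebraMap L Ω).injective).1 halg

/-- Rational functions with algebraic coefficients that lie in `L` have their coefficients in `L`,
once they are normalised. -/
theorem mem_adjoin_of_algebraMap_mem_adjoin_X {x : L} (hx : algebraMap L Ω x ∈
      (algebraicClosure F Ω)⟮algebraMap (RatFunc F) Ω RatFunc.X⟯) :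
    x ∈ adjoin (RatFunc F) (algebraicClosure F L : Set L) := by
  classical
  set t := algebraMap (RatFunc F) Ω RatFunc.X with ht
  have hinj : Function.Injective (aeval t : (algebraicClosure F Ω)[X] →ₐ[_] Ω) :=
    transcendental_iff_injective.1 (RatFunc.transcendental_algebraMap_X_of_isAlgebraic F _ Ω)
  -- A monic denominator of least degree is fixed by every automorphism over `L`: otherwise its
  -- difference with its conjugate would be a denominator of smaller degree.
  have hex : ∃ n : ℕ, ∃ P Q : (algebraicClosure F Ω)[X], Q ≠ 0 ∧ Q.natDegree = n ∧
      algebraMap L Ω x * aeval t Q = aeval t P := by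
    obtain ⟨P, Q, h⟩ := (mem_adjoin_simple_iff _ _).1 hx
    obtain rfl | hQ := eq_or_ne Q 0
    · exact ⟨0, 0, 1, one_ne_zero, natDegree_one, by simp [h]⟩
    · refine ⟨_, P, Q, hQ, rfl, ?_⟩
      rw [h, div_mul_cancel₀]
      exact fun h0 => hQ (hinj (by rw [h0, map_zero]))
  obtain ⟨P, Q, hQm, hQn, hPQ⟩ : ∃ P Q : (algebraicClosure F Ω)[X], Q.Monic ∧
      Q.natDegree = Nat.find hex ∧ algebraMap L Ω x * aeval t Q = aeval t P := by
    obtain ⟨P, Q, hQ, hQn, h⟩ := Nat.find_spec hex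
    refine ⟨C Q.leadingCoeff⁻¹ * P, C Q.leadingCoeff⁻¹ * Q, ?_, ?_, ?_⟩
    · rw [mul_comm]
      exact monic_mul_leadingCoeff_inv hQ
    · rw [natDegree_C_mul (inv_ne_zero (leadingCoeff_ne_zero.2 hQ)), hQn]
    · rw [map_mul, map_mul, mul_left_comm, h]
  have hnorm : Normal F (algebraicClosure F Ω) := IsAlgClosure.normal F _
  let r : (Ω ≃ₐ[L] Ω) → (algebraicClosure F Ω ≃ₐ[F] algebraicClosure F Ω) := fun s =>
    (s.restrictScalars F).restrictNormal _
  have hr : ∀ s (c : algebraicClosure F Ω), ((r s c : algebraicClosure F Ω) : Ω) = s c :=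
    fun s c => (s.restrictScalars F).restrictNormal_commutes (algebraicClosure F Ω) c
  have hst : ∀ s : Ω ≃ₐ[L] Ω, s t = t := fun s => by
    rw [ht, IsScalarTower.algebraMap_apply (RatFunc F) L Ω, s.commutes]
  have haeval : ∀ (s : Ω ≃ₐ[L] Ω) (q : (algebraicClosure F Ω)[X]),
      s (aeval t q) = aeval t (q.map (r s : algebraicClosure F Ω →+* algebraicClosure F Ω)) := by
    intro s q
    rw [aeval_def, aeval_def, eval₂_map]
    have := hom_eval₂ q (algebraMap (algebraicClosure F Ω) Ω) (s : Ω →+* Ω) t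
    rw [RingHom.coe_coe, hst] at this
    rw [this]
    congr 1
    ext c
    exact (hr s c).symm
  have hQs : ∀ s, Q.map (r s : algebraicClosure F Ω →+* algebraicClosure F Ω) = Q := by
    intro s
    by_contra hne
    set Q' := Q.map (r s : algebraicClosure F Ω →+* algebraicClosure F Ω) with hQ'
    have hdeg : Q'.degree = Q.degree := degree_map _ _
    have hsub : Q - Q' ≠ 0 := fun h => hne (sub_eq_zero.1 h).symm
    have hlt : (Q - Q').natDegree < Q.natDegree := by
      refine natDegree_lt_natDegree hsub (degree_sub_lt_left hdeg.symm hQm.ne_zero ?_)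
      rw [hQm.leadingCoeff, (hQm.map _).leadingCoeff]
    rw [hQn] at hlt
    refine Nat.find_min hex hlt ⟨P - P.map (r s : _ →+* algebraicClosure F Ω), Q - Q', hsub, rfl, ?_⟩
    rw [map_sub, map_sub, mul_sub, hPQ, hQ', ← haeval, ← haeval, ← hPQ, map_mul, s.commutes]
  have hPs : ∀ s, P.map (r s : algebraicClosure F Ω →+* algebraicClosure F Ω) = P := by
    intro s
    refine hinj ?_
    rw [← haeval, ← hPQ, map_mul, haeval, hQs, s.commutes]
  have hfix : ∀ q : (algebraicClosure F Ω)[X],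
      (∀ s, q.map (r s : algebraicClosure F Ω →+* algebraicClosure F Ω) = q) →
      ∀ (s : Ω ≃ₐ[L] Ω) (i : ℕ), s (q.coeff i : Ω) = q.coeff i := by
    intro q hq s i
    rw [← hr]
    conv_rhs => rw [← hq s, coeff_map]
    rfl
  obtain ⟨u, hu, hu'⟩ := exists_mem_adjoin_algebraMap_eq_aeval (hfix P hPs)
  obtain ⟨v, hv, hv'⟩ := exists_mem_adjoin_algebraMap_eq_aeval (hfix Q hQs)
  have hv0 : algebraMap L Ω v ≠ 0 := by
    rw [hv']
    exact fun h0 => hQm.ne_zero (hinj (by rw [h0, map_zero]))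
  have hxuv : x = u / v := by
    refine (algebraMap L Ω).injective ?_
    rw [map_div₀, eq_div_iff hv0, hu', hv', hPQ]
  rw [hxuv]
  exact div_mem hu hv

end Adjoin

theorem IntermediateField.mem_adjoin_simple_of_algebraMap_mem {C N Ω : Type*} [Field C] [Field N]
    [Field Ω] [Algebra C Ω] [Algebra N Ω] {K : IntermediateField C Ω}
    (hN : ∀ n : N, algebraMap N Ω n ∈ K) {ζ : Ω} (hζ : ζ ∈ K) {x : Ω} (hx : x ∈ N⟮ζ⟯) : x ∈ K := by
  have key : ∀ q : N[X], aeval ζ q ∈ K := fun q => by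
    rw [aeval_eq_sum_range]
    refine sum_mem fun i _ => ?_
    rw [Algebra.smul_def]
    exact mul_mem (hN _) (pow_mem hζ _)
  obtain ⟨p, q, rfl⟩ := (mem_adjoin_simple_iff N x).1 hx
  exact div_mem (key p) (key q)

/-- `[L(ζ) : L]` is at most `φ(l)`. That it is less than `l` makes adjoining `ζ` harmless for
ramification of prime order `l`. -/
theorem IsPrimitiveRoot.natDegree_minpoly_lt_of_mem_adjoin {L Ω : Type*} [Field L] [Field Ω]
    [Algebra L Ω] {ζ : Ω} {l : ℕ} (hl : 1 < l) (hζ : IsPrimitiveRoot ζ l) {x : Ω} (hx : x ∈ L⟮ζ⟯) :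
    (minpoly L x).natDegree < l := by
  have hint : IsIntegral L ζ := (hζ.isIntegral (by omega)).tower_top
  have : FiniteDimensional L L⟮ζ⟯ := adjoin.finiteDimensional hint
  have h1 := minpoly.natDegree_le (A := L) (⟨x, hx⟩ : L⟮ζ⟯)
  rw [minpoly_eq, adjoin.finrank hint] at h1
  have h2 : (minpoly L ζ).natDegree ≤ (cyclotomic l L).natDegree := by
    refine natDegree_le_of_dvd (minpoly.dvd L ζ ?_) (cyclotomic_ne_zero l L)
    rw [aeval_def, eval₂_eq_eval_map, map_cyclotomic]
    exact (isRoot_cyclotomic (by omega) hζ)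
  rw [natDegree_cyclotomic] at h2
  exact (h1.trans h2).trans_lt (Nat.totient_lt l hl)

/-! ### The two cases for the prime degree, and the theorem -/

section Final

variable {F L : Type*} [Field F] [PerfectField F] [Field L] [Algebra F L] [Algebra (RatFunc F) L]
  [IsScalarTower F (RatFunc F) L] [IsAbelianGalois (RatFunc F) L]

theorem false_of_finrank_eq_char (htame : IsTamelyRamifiedExtension F (RatFunc F) L)
    {p : ℕ} [hp : Fact p.Prime] [CharP F p]
    {M : IntermediateField (RatFunc F) L}
    (hM : M = adjoin (RatFunc F) (algebraicClosure F L : Set L)) (N : IntermediateField M L)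
    (hN : Module.finrank M N = p) : False := by
  have : FiniteDimensional M N :=
    Module.finite_of_finrank_pos (hN ▸ hp.out.pos)
  have : CharP L p := charP_of_injective_algebraMap (algebraMap F L).injective p
  have : CharP N p := (algebraMap N L).charP (algebraMap N L).injective p
  have : CharP (algebraicClosure F L) p :=
    charP_of_injective_algebraMap (algebraMap F (algebraicClosure F L)).injective p
  obtain ⟨y, hy, c, hc⟩ := IsGalois.exists_artinSchreier hN
  refine hy ⟨⟨y, ?_⟩, rfl⟩
  have hyc : (y : L) ^ p - y ∈ (algebraicClosure F L)⟮algebraMap (RatFunc F) L RatFunc.X⟯ := by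
    have := algebraMap_mem_adjoin_X_of_mem_adjoin (Ω := L) (C := algebraicClosure F L)
      (fun e he => ⟨⟨e, he⟩, rfl⟩) (hM.le c.2)
    convert this using 1
    exact (congrArg Subtype.val hc).symm
  obtain ⟨h, hh, halg⟩ := exists_isAlgebraic_sub_of_artinSchreier (F := F) (p := p)
    (fun V hV hF z hz => PrimeDivisor.IsTameOver.mem_unitsMulBase (Q := ⟨V, hV, hF⟩) (htame _) hp.out hz) hyc
  have hmem : (y : L) - h ∈ algebraicClosure F L :=
    mem_algebraicClosure_iff.2 (halg.restrictScalars F)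
  refine hM.ge ?_
  refine mem_adjoin_of_mem_adjoin_X ?_
  rw [← sub_add_cancel (y : L) h]
  exact add_mem (IntermediateField.algebraMap_mem _ (⟨_, hmem⟩ : algebraicClosure F L)) hh

theorem false_of_finrank_ne_char {Ω : Type*} [Field Ω] [IsAlgClosed Ω] [Algebra L Ω]
    [Algebra.IsAlgebraic L Ω] [Algebra F Ω] [Algebra (RatFunc F) Ω] [IsScalarTower F L Ω]
    [IsScalarTower (RatFunc F) L Ω] [IsScalarTower F (RatFunc F) Ω]
    (p₀ : PrimeDivisor F (RatFunc F)) (hdeg : p₀.degree = 1)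
    (hram : ∀ P : PrimeDivisor F (RatFunc F), P.IsRamifiedIn L → P = p₀)
    {M : IntermediateField (RatFunc F) L}
    (hM : M = adjoin (RatFunc F) (algebraicClosure F L : Set L)) (N : IntermediateField M L)
    (hN : (Module.finrank M N).Prime)
    (hchar : (Module.finrank M N : F) ≠ 0) :
    False := by
  set l := Module.finrank M N with hl
  have hfin : FiniteDimensional M N := Module.finite_of_finrank_pos hN.pos
  have halgM : Algebra.IsAlgebraic M Ω := Algebra.IsAlgebraic.trans M L Ω
  have hacΩ : IsAlgClosure M Ω := ⟨inferInstance, halgM⟩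
  have hacL : IsAlgClosure L Ω := ⟨inferInstance, inferInstance⟩
  have : Normal M Ω := IsAlgClosure.normal M Ω
  have : Normal L Ω := IsAlgClosure.normal L Ω
  set t := algebraMap (RatFunc F) Ω RatFunc.X with ht
  have : IsAlgClosed (algebraicClosure F Ω) := IsAlgClosure.isAlgClosed F
  have : NeZero (l : algebraicClosure F Ω) := ⟨by
    rw [← map_natCast (algebraMap F (algebraicClosure F Ω))]
    exact (_root_.map_ne_zero _).2 hchar⟩
  obtain ⟨ζ, hζ⟩ := HasEnoughRootsOfUnity.exists_primitiveRoot (algebraicClosure F Ω) l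
  have hζΩ : IsPrimitiveRoot (ζ : Ω) l :=
    hζ.map_of_injective (algebraMap (algebraicClosure F Ω) Ω).injective
  have hζmem : (ζ : Ω) ∈ (algebraicClosure F Ω)⟮t⟯ := IntermediateField.algebraMap_mem _ ζ
  have hMmem : ∀ m : M, algebraMap M Ω m ∈ (algebraicClosure F Ω)⟮t⟯ := fun m =>
    algebraMap_mem_adjoin_X_of_mem_adjoin (L := L) (fun e he => ⟨⟨algebraMap L Ω e,
      mem_algebraicClosure_iff.2 ((mem_algebraicClosure_iff.1 he).algebraMap)⟩, rfl⟩) (hM.le m.2)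
  have hunram : ∀ V : ValuationSubring Ω, V ≠ ⊤ →
      (∀ c : algebraicClosure F Ω, algebraMap (algebraicClosure F Ω) Ω c ∈ V) →
      V.comap (algebraMap (RatFunc F) Ω) ≠ p₀.ring → ∀ z : Ωˣ, (z : Ω) ∈ N⟮(ζ : Ω)⟯ →
      z ^ l ∈ V.baseValued (RatFunc F) → z ∈ V.baseValued (RatFunc F) := by
    intro V hV hC hne z hz hzl
    have hzL : (z : Ω) ∈ L⟮(ζ : Ω)⟯ := mem_adjoin_simple_of_algebraMap_mem (N := N)
      (fun n => L⟮(ζ : Ω)⟯.algebraMap_mem (n : L)) (mem_adjoin_simple_self L _) hz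
    obtain ⟨j, hj0, hj, hzj⟩ := IsAlgebraic.exists_pow_mem_baseValued V
      (Algebra.IsAlgebraic.isAlgebraic (R := L) (z : Ω))
    -- Some `z ^ j` with `0 < j < l` has a value from `L`, hence from `F(t)` away from `p₀`. As `j`
    -- is prime to `l`, this combines with `z ^ l`.
    have hjl := hj.trans_lt (hζΩ.natDegree_minpoly_lt_of_mem_adjoin hN.one_lt hzL)
    refine Subgroup.mem_of_pow_mem_of_coprime _
      (V.baseValued_le_of_forall_isRamifiedIn hram hV (fun c => ?_) hne hzj) hzl
      (Nat.coprime_of_lt_prime hj0.ne' hjl hN).symm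
    exact hC (algebraMap F _ c)
  have hmem : ∀ θ : Ω, θ ∈ N⟮(ζ : Ω)⟯ → θ ^ l ∈ M⟮(ζ : Ω)⟯ → θ ∈ (algebraicClosure F Ω)⟮t⟯ := by
    intro θ hθN hθM
    obtain rfl | hθ := eq_or_ne θ 0
    · exact zero_mem _
    refine mem_adjoin_of_pow_mem_adjoin (z := Units.mk0 θ hθ) hN.pos ?_
      (mem_adjoin_simple_of_algebraMap_mem hMmem hζmem hθM)
    -- If `p₀` is finite, degree one gives `a` in `F` with `X - a` a nonunit, and `t = a` is the
    -- only exceptional place. Otherwise `p₀` is the place at infinity.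
    by_cases hX : RatFunc.X ∈ p₀.ring
    · right
      obtain ⟨a, ha⟩ := p₀.exists_sub_mem_nonunits_of_degree_eq_one hdeg hX
      refine ⟨algebraMap F _ a, fun V hV hC hVa => hunram V hV hC ?_ _ hθN⟩
      intro h
      have h1 : RatFunc.X - algebraMap F (RatFunc F) a ≠ 0 := by
        intro h0
        have := RatFunc.transcendental_algebraMap_X F (RatFunc F)
        rw [sub_eq_zero.1 h0] at this
        exact this (isAlgebraic_algebraMap a)
      refine ((ValuationSubring.mem_nonunits_iff_or _).1 ha).resolve_left h1 ?_
      rw [← h, ValuationSubring.mem_comap, ← V.valuation_le_one_iff, map_inv₀, map_inv₀]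
      refine inv_le_one_of_one_le₀ ?_
      convert hVa using 2
      rw [map_sub, map_sub, aeval_X, aeval_C, ← IsScalarTower.algebraMap_apply,
        ← IsScalarTower.algebraMap_apply]
    · left
      intro V hV hC hVt
      refine hunram V hV hC ?_ _ hθN
      rintro h
      exact hX (h ▸ ValuationSubring.mem_comap.2 hVt)
  have hbot : ∀ y : N, (y : L) ∈ M := by
    intro y
    obtain ⟨θ, hθN, hθM, hsum⟩ := IsGalois.exists_lagrangeResolvents hN hζΩ y
    refine hM.ge ?_
    refine mem_adjoin_of_algebraMap_mem_adjoin_X (Ω := Ω) ?_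
    have hl0 : (l : Ω) ≠ 0 := by
      rw [← map_natCast (algebraMap F Ω)]
      exact (_root_.map_ne_zero _).2 hchar
    have hy : algebraMap L Ω y = (∑ j ∈ Finset.range l, θ j) / l := by
      rw [hsum, mul_div_cancel_left₀ _ hl0]
      rfl
    rw [hy]
    exact div_mem (sum_mem fun j _ => hmem _ (hθN j) (hθM j)) (_root_.natCast_mem _ l)
  have hN1 : N = ⊥ := le_bot_iff.1 fun y hy => mem_bot.2 ⟨⟨y, hbot ⟨y, hy⟩⟩, rfl⟩
  refine hN.one_lt.ne' ?_
  rw [hl, hN1]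
  exact IntermediateField.finrank_bot

end Final

theorem proposition3p3 {F : Type*} [Field F] [Finite F]
    {L : Type*} [Field L] [Algebra F L] [Algebra (RatFunc F) L] [IsScalarTower F (RatFunc F) L]
    [IsAbelianGalois (RatFunc F) L]
    (htame : IsTamelyRamifiedExtension F (RatFunc F) L)
    (p₀ : PrimeDivisor F (RatFunc F)) (hdeg : p₀.degree = 1)
    (hram : ∀ P : PrimeDivisor F (RatFunc F), P.IsRamifiedIn L → P = p₀) :
    IsConstantExtension F (RatFunc F) L := by
  refine ⟨algebraicClosure F L, inferInstance, ?_⟩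
  by_contra hne
  obtain ⟨x, hx⟩ : ∃ x : L, x ∉ adjoin (RatFunc F) (algebraicClosure F L : Set L) := by
    by_contra! h
    exact hne (eq_top_iff.2 fun x _ => h x)
  obtain ⟨N, hN⟩ := IsAbelianGalois.exists_intermediateField_finrank_prime
    (M := adjoin (RatFunc F) (algebraicClosure F L : Set L)) (x := x) fun h => by
      obtain ⟨c, rfl⟩ := mem_bot.1 h
      exact hx c.2
  by_cases hchar :
      (Module.finrank (adjoin (RatFunc F) (algebraicClosure F L : Set L)) N : F) = 0
  · have : Fact (Module.finrank (adjoin (RatFunc F) (algebraicClosure F L : Set L)) N).Prime :=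
      ⟨hN⟩
    have := (CharP.charP_iff_prime_eq_zero hN).2 hchar
    exact false_of_finrank_eq_char htame rfl N rfl
  · have : IsScalarTower F (RatFunc F) (AlgebraicClosure L) := .of_algebraMap_eq fun c => by
      rw [IsScalarTower.algebraMap_apply F L (AlgebraicClosure L),
        IsScalarTower.algebraMap_apply F (RatFunc F) L,
        ← IsScalarTower.algebraMap_apply (RatFunc F) L (AlgebraicClosure L)]
    exact false_of_finrank_ne_char (Ω := AlgebraicClosure L) p₀ hdeg hram rfl N hN hchar
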